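/- **Setting.** Let $A_\star\in\mathbb R^{n\times n}$, $B_\star\in\mathbb R^{n\times p}$, $Q\succeq 0$, $R\succ 0$, and consider $x_{k+1}=A_\star x_k+B_\star u_k+w_k$, $x_0=0$, with $w_k$ i.i.d. $\mathcal N(0,I_n)$. The LQR cost of a control policy is $J=\lim_{T\to\infty}\frac1T\mathbb E\sum_{k=1}^T (x_k^\top Qx_k+u_k^\top Ru_k)$. Let $J_\star$ be the minimal cost over all policies in which $u_k$ is a measurable function of the states up to time $k$ and of extra randomness independent of the noise, and let $K_\star$ be a static feedback $u_k=K_\star x_k$ that attains it. $J(A_\star,B_\star,\mathbf K)$ is the cost of the linear time-invariant controller $\mathbf u=\mathbf K\mathbf x$. $\|\cdot\|$ is the spectral norm. For a transfer matrix $\mathbf M(z)=\sum_{k\ge0}M(k)z^{-k}$ put $\|\mathbf M\|_{\mathcal H_\infty}=\sup_{|z|=1}\|\mathbf M(z)\|$ and $\|\mathbf M\|_{\mathcal H_2}^2=\sum_k\|M(k)\|_F^2$. $\mathcal{RH}_\infty(C,\rho)$ is the set of rational $\mathbf M$, analytic on $|z|\ge1$ (including $\infty$), with $\|M(k)\|\le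 C\rho^k$ for all $k\ge1$; $\frac1z\mathcal{RH}^F_\infty(C,\rho)$ is the set of those with moreover $M(0)=0$ and $M(k)=0$ for $k>F$. Write $\mathfrak R_M=(zI-M)^{-1}=\sum_{k\ge1}M^{k-1}z^{-k}$ and $\zeta=\varepsilon(1+\|K_\star\|)\,\|\mathfrak R_{A_\star+B_\star K_\star}\|_{\mathcal H_\infty}$. Given $\widehat A,\widehat B,\varepsilon,C_x,C_u,\rho,F$, the FIR-truncated robust SLS program is to minimize $$\frac1{1-\gamma}\left\|\begin{bmatrix}Q^{1/2}&0\\0&R^{1/2}\end{bmatrix}\begin{bmatrix}\mathbf\Phi_x\\\mathbf\Phi_u\end{bmatrix}\right\|_{\mathcal H_2}$$ over $\gamma\in[0,1)$, $V\in\mathbb R^{n\times n}$, $\mathbf\Phi_x\in\frac1z\mathcal{RH}_\infty^F(C_x,\rho)$, $\mathbf\Phi_u\in\frac1z\mathcal{RH}_\infty^F(C_u,\rho)$ subject to $$\begin{bmatrix}zI-\widehat A&-\widehat B\end{bmatrix}\begin{bmatrix}\mathbf\Phi_x\\\mathbf\Phi_u\end{bmatrix}=I+z^{-F}V,\qquad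 \frac{\sqrt2\,\varepsilon}{1-C_x\rho^{F+1}}\left\|\begin{bmatrix}\mathbf\Phi_x\\\mathbf\Phi_u\end{bmatrix}\right\|_{\mathcal H_\infty}\le\gamma,\qquad \|V\|\le C_x\rho^{F+1}.$$ **Theorem.** There are absolute constants $c_x,c_u,c_J,c_\varepsilon,c_X,c_U>0$ such that the following holds for all $n,p$ and all $(A_\star,B_\star,Q,R)$ with $J_\star,K_\star$ as above. Suppose $\mathfrak R_{A_\star+B_\star K_\star}\in\mathcal{RH}_\infty(C_\star,\rho_\star)$ with $1/e\le\rho_\star<1$, and $$\zeta\le\tfrac15,\qquad \varepsilon(1+\|K_\star\|)C_\star\le1-\rho_\star,\qquad \max\{\|\widehat A-A_\star\|,\|\widehat B-B_\star\|\}\le\varepsilon .$$ Put $C_x=\frac{c_xC_\star}{1-\rho_\star}$, $C_u=\frac{c_u\|K_\star\|C_\star}{1-\rho_\star}$, $\rho=\frac14\rho_\star+\frac34$. Fix $C_J>0$ and let $$F_0\ \ge\ \frac{\log(2C_x)}{\log(1/\rho)}-1,\qquad F_0\ \ge\ \frac{\log((1+C_J^{-1})C_x)}{\log(1/\rho)}-1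 .$$ Then for every integer $F\ge F_0$: (a) the program is feasible, and it has an optimal solution; (b) for every optimal solution $(\gamma,\mathbf\Phi_x,\mathbf\Phi_u,V)$, the controller $\mathbf K(F)=\mathbf\Phi_u\mathbf\Phi_x^{-1}$ satisfies (the limit defining the left side exists) $$J(A_\star,B_\star,\mathbf K(F))\le(1+C_J)^2(1+c_J\,\zeta)^2J_\star ;$$ (c) if furthermore $\varepsilon(C_x+C_u)\le c_\varepsilon(1-\rho_\star)^2$ and $F\ge\frac{2\log(C_x/2)}{\log(1/\rho)}-2$ (that is, $C_x\rho^{F+1}\le2\rho^{F/2}$), then the closed-loop responses $\widehat{\mathbf\Phi}_x=(zI-A_\star-B_\star\mathbf K(F))^{-1}$ and $\widehat{\mathbf\Phi}_u=\mathbf K(F)\widehat{\mathbf\Phi}_x$ on the true system satisfy $$\widehat{\mathbf\Phi}_x\in\mathcal{RH}_\infty\!\Big(\frac{c_XC_\star}{(1-\rho_\star)^3},\,.999+.001\rho_\star\Big),\qquad \widehat{\mathbf\Phi}_u\in\mathcal{RH}_\infty\!\Big(\frac{c_U\|K_\star\|C_\star}{(1-\rho_\star)^3},\,.999+.001\rho_\star\Big).$$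 -/

import Mathlib

open Filter Topology MeasureTheory ProbabilityTheory
open scoped ENNReal Matrix Matrix.Norms.L2Operator MatrixOrder

/- Throughout, `‖M‖` for a matrix `M` is the spectral norm (the operator norm between Euclidean
spaces).  A causal transfer matrix `M(z) = ∑_{k ≥ 0} M[k] z^{-k}` is given by its impulse response
`k ↦ M[k]`. -/

namespace LQR

noncomputable section

/-! ### Transfer matrices -/

/-- Impulse response of a causal transfer matrix. -/
abbrev TransferMatrix (m n : Type*) := ℕ → Matrix m n ℝ

/-- `M(z)` is a rational function of `z`: for some nonzero real polynomial `q`, `q(z) M(z)` is a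
polynomial in `z`, i.e. its coefficient of `z^{-j}` vanishes for all `j ≥ 1`. -/
def IsRational {m n : Type*} (M : TransferMatrix m n) : Prop :=
  ∃ q : Polynomial ℝ, q ≠ 0 ∧ ∀ j : ℕ, 1 ≤ j → q.sum (fun i c => c • M (j + i)) = 0

/-- The space `RH_∞` of proper rational transfer matrices without poles in `|z| ≥ 1`; for a
rational `M` the latter says that the impulse response decays geometrically. -/
def IsRHinf {m n : Type*} [Fintype m] [Fintype n] [DecidableEq n]
    (M : TransferMatrix m n) : Prop :=
  IsRational M ∧ ∃ c r : ℝ, r < 1 ∧ 0 ≤ r ∧ ∀ k, ‖M k‖ ≤ c * r ^ k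

/-- The class `RH_∞(C, ρ)`. -/
def RHinf {m n : Type*} [Fintype m] [Fintype n] [DecidableEq n]
    (C ρ : ℝ) : Set (TransferMatrix m n) :=
  {M | IsRHinf M ∧ ∀ k : ℕ, 1 ≤ k → ‖M k‖ ≤ C * ρ ^ k}

/-- The class `(1/z) RH_∞^F(C, ρ)`: strictly proper finite impulse responses of length `F`. -/
def strictFIR {m n : Type*} [Fintype m] [Fintype n] [DecidableEq n]
    (F : ℕ) (C ρ : ℝ) : Set (TransferMatrix m n) :=
  {M | M ∈ RHinf C ρ ∧ M 0 = 0 ∧ ∀ k : ℕ, F < k → M k = 0}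

/-- The value `M(z) = ∑_k M[k] z^{-k}`. -/
def TransferMatrix.eval {m n : Type*} (M : TransferMatrix m n) (z : ℂ) : Matrix m n ℂ :=
  ∑' k : ℕ, (z⁻¹ ^ k) • (M k).map (fun a : ℝ => (a : ℂ))

/-- The `H_∞` norm, `sup_{|z| = 1} ‖M(z)‖`. -/
def hinfNorm {m n : Type*} [Fintype m] [Fintype n] [DecidableEq n]
    (M : TransferMatrix m n) : ℝ :=
  ⨆ z : Circle, ‖TransferMatrix.eval M (z : ℂ)‖

/-- The `H_2` norm, `(∑_k ‖M[k]‖_F²)^{1/2}`. -/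
def h2Norm {m n : Type*} [Fintype m] [Fintype n] (M : TransferMatrix m n) : ℝ :=
  Real.sqrt (∑' k : ℕ, ∑ i, ∑ j, (M k i j) ^ 2)

/-- The stacked transfer matrix `[M; N]`. -/
def stack {m₁ m₂ n : Type*} (M : TransferMatrix m₁ n) (N : TransferMatrix m₂ n) :
    TransferMatrix (m₁ ⊕ m₂) n :=
  fun k => Matrix.fromRows (M k) (N k)

/-- The constant (static) transfer matrix `K`. -/
def const {m n : Type*} (K : Matrix m n ℝ) : TransferMatrix m n :=
  fun k => if k = 0 then K else 0

/-- The resolvent `(zI - M)^{-1} = ∑_{k ≥ 1} M^{k-1} z^{-k}`. -/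
def res {n : ℕ} (M : Matrix (Fin n) (Fin n) ℝ) : TransferMatrix (Fin n) (Fin n)
  | 0 => 0
  | k + 1 => M ^ k

/-- The controller `K = Φ_u Φ_x^{-1} = (z Φ_u) (z Φ_x)^{-1}`, for strictly proper `Φ_x`, `Φ_u`
with `Φ_x[1] = I`; the inverse is that of power series in `z^{-1}`. -/
def controller {n p : ℕ} (Φx : TransferMatrix (Fin n) (Fin n))
    (Φu : TransferMatrix (Fin p) (Fin n)) : TransferMatrix (Fin p) (Fin n) :=
  fun k => ∑ ij ∈ Finset.HasAntidiagonal.antidiagonal k,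
    Φu (ij.1 + 1) *
      PowerSeries.coeff ij.2 (PowerSeries.invOfUnit (PowerSeries.mk fun l => Φx (l + 1)) 1)

/-- The closed-loop response from `w` to `x` of the controller `K` on `(A, B)`:
`(zI - A - B K)^{-1} = z^{-1} (I - z^{-1} (A + B K))^{-1}`. -/
def responseX {n p : ℕ} (A : Matrix (Fin n) (Fin n) ℝ) (B : Matrix (Fin n) (Fin p) ℝ)
    (K : TransferMatrix (Fin p) (Fin n)) : TransferMatrix (Fin n) (Fin n)
  | 0 => 0
  | k + 1 => PowerSeries.coeff k (PowerSeries.invOfUnit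
      (1 - PowerSeries.X * PowerSeries.mk fun l => const A l + B * K l) 1)

/-- The closed-loop response from `w` to `u`: `K (zI - A - B K)^{-1}`. -/
def responseU {n p : ℕ} (A : Matrix (Fin n) (Fin n) ℝ) (B : Matrix (Fin n) (Fin p) ℝ)
    (K : TransferMatrix (Fin p) (Fin n)) : TransferMatrix (Fin p) (Fin n) :=
  fun k => ∑ ij ∈ Finset.HasAntidiagonal.antidiagonal k, K ij.1 * responseX A B K ij.2

/-! ### The LQR cost -/

/-- A (possibly randomized, time-varying, nonlinear) control policy: `u_k` is a measurable function
of the states `x_0, …, x_k` and of a random seed which is independent of the noise. -/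
structure Policy (n p : ℕ) where
  seedLaw : Measure (ℕ → ℝ)
  isProbabilityMeasure_seedLaw : IsProbabilityMeasure seedLaw
  act : (k : ℕ) → (Fin (k + 1) → Fin n → ℝ) → (ℕ → ℝ) → Fin p → ℝ
  measurable_act : ∀ k, Measurable fun q : (Fin (k + 1) → Fin n → ℝ) × (ℕ → ℝ) => act k q.1 q.2

/-- The LTI feedback `u_k = ∑_{j ≤ k} K[j] x_{k-j}`. -/
def ltiPolicy {n p : ℕ} (K : TransferMatrix (Fin p) (Fin n)) : Policy n p where
  seedLaw := Measure.dirac 0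
  isProbabilityMeasure_seedLaw := inferInstance
  act k x _ := ∑ j : Fin (k + 1), K j *ᵥ x j.rev
  measurable_act k := by
    refine Finset.measurable_sum _ fun j _ => ?_
    refine measurable_pi_lambda _ fun i => ?_
    simp only [Matrix.mulVec, dotProduct]
    fun_prop

/-- The law of the noise sequence `w_0, w_1, …`, i.i.d. `N(0, I_n)`. -/
def noiseLaw (n : ℕ) : Measure (ℕ → Fin n → ℝ) :=
  Measure.infinitePi fun _ => Measure.pi fun _ => gaussianReal 0 1

/-- The states `x_0, …, x_k` of `x_{k+1} = A x_k + B u_k + w_k`, `x_0 = 0`, under a policy. -/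
def history {n p : ℕ} (A : Matrix (Fin n) (Fin n) ℝ) (B : Matrix (Fin n) (Fin p) ℝ)
    (π : Policy n p) (w : ℕ → Fin n → ℝ) (s : ℕ → ℝ) : (k : ℕ) → Fin (k + 1) → Fin n → ℝ
  | 0 => fun _ => 0
  | k + 1 => Fin.snoc (α := fun _ => Fin n → ℝ) (history A B π w s k)
      (A *ᵥ history A B π w s k (Fin.last k) + B *ᵥ π.act k (history A B π w s k) s + w k)

/-- The state `x_k`. -/
def state {n p : ℕ} (A : Matrix (Fin n) (Fin n) ℝ) (B : Matrix (Fin n) (Fin p) ℝ)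
    (π : Policy n p) (w : ℕ → Fin n → ℝ) (s : ℕ → ℝ) (k : ℕ) : Fin n → ℝ :=
  history A B π w s k (Fin.last k)

/-- The input `u_k`. -/
def input {n p : ℕ} (A : Matrix (Fin n) (Fin n) ℝ) (B : Matrix (Fin n) (Fin p) ℝ)
    (π : Policy n p) (w : ℕ → Fin n → ℝ) (s : ℕ → ℝ) (k : ℕ) : Fin p → ℝ :=
  π.act k (history A B π w s k) s

/-- The average expected cost `(1/T) E ∑_{k=1}^T (x_kᵀ Q x_k + u_kᵀ R u_k)`. -/
def averageCost {n p : ℕ} (A : Matrix (Fin n) (Fin n) ℝ) (B : Matrix (Fin n) (Fin p) ℝ)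
    (Q : Matrix (Fin n) (Fin n) ℝ) (R : Matrix (Fin p) (Fin p) ℝ) (π : Policy n p) (T : ℕ) :
    ℝ≥0∞ :=
  (∫⁻ ws, ENNReal.ofReal (∑ k ∈ Finset.Icc 1 T,
      (state A B π ws.1 ws.2 k ⬝ᵥ (Q *ᵥ state A B π ws.1 ws.2 k) +
        input A B π ws.1 ws.2 k ⬝ᵥ (R *ᵥ input A B π ws.1 ws.2 k)))
    ∂((noiseLaw n).prod π.seedLaw)) / (T : ℝ≥0∞)

/-- `J` is the infinite-horizon LQR cost of the policy on `(A, B)`. -/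
def HasLQRCost {n p : ℕ} (A : Matrix (Fin n) (Fin n) ℝ) (B : Matrix (Fin n) (Fin p) ℝ)
    (Q : Matrix (Fin n) (Fin n) ℝ) (R : Matrix (Fin p) (Fin p) ℝ) (π : Policy n p) (J : ℝ≥0∞) :
    Prop :=
  Tendsto (averageCost A B Q R π) atTop (𝓝 J)

/-- `J` is the minimal LQR cost over all policies, and the static feedback `u_k = K x_k`
attains it. -/
structure IsOptimalFeedback {n p : ℕ} (A : Matrix (Fin n) (Fin n) ℝ)
    (B : Matrix (Fin n) (Fin p) ℝ) (Q : Matrix (Fin n) (Fin n) ℝ) (R : Matrix (Fin p) (Fin p) ℝ)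
    (K : Matrix (Fin p) (Fin n) ℝ) (J : ℝ≥0∞) : Prop where
  isLeast : IsLeast {J' | ∃ π : Policy n p, HasLQRCost A B Q R π J'} J
  attains : HasLQRCost A B Q R (ltiPolicy (const K)) J

/-! ### The FIR-truncated robust synthesis program -/

/-- Data of the program: estimates, weights, error level, and class parameters. -/
structure Program (n p : ℕ) where
  Ahat : Matrix (Fin n) (Fin n) ℝ
  Bhat : Matrix (Fin n) (Fin p) ℝ
  Q : Matrix (Fin n) (Fin n) ℝ
  R : Matrix (Fin p) (Fin p) ℝ
  ε : ℝ
  Cx : ℝ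
  Cu : ℝ
  ρ : ℝ
  F : ℕ

/-- The decision variables. -/
structure Decision (n p : ℕ) where
  γ : ℝ
  Φx : TransferMatrix (Fin n) (Fin n)
  Φu : TransferMatrix (Fin p) (Fin n)
  V : Matrix (Fin n) (Fin n) ℝ

/-- The constraints.  `affine_zero` and `affine` are the equation
`[zI - Ahat, -Bhat] [Φx; Φu] = I + z^{-F} V`, read off at `z^1` and at `z^{-k}`, `k ≥ 0`. -/
structure Program.Feasible {n p : ℕ} (P : Program n p) (D : Decision n p) : Prop where
  γ_nonneg : 0 ≤ D.γ
  γ_lt_one : D.γ < 1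
  affine_zero : D.Φx 0 = 0
  affine : ∀ k : ℕ, D.Φx (k + 1) - P.Ahat * D.Φx k - P.Bhat * D.Φu k =
    (if k = 0 then 1 else 0) + (if k = P.F then D.V else 0)
  robust : Real.sqrt 2 * P.ε / (1 - P.Cx * P.ρ ^ (P.F + 1)) * hinfNorm (stack D.Φx D.Φu) ≤ D.γ
  norm_V : ‖D.V‖ ≤ P.Cx * P.ρ ^ (P.F + 1)
  memX : D.Φx ∈ strictFIR P.F P.Cx P.ρ
  memU : D.Φu ∈ strictFIR P.F P.Cu P.ρ

/-- The objective `(1 - γ)^{-1} ‖diag(Q^{1/2}, R^{1/2}) [Φx; Φu]‖_{H_2}`. -/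
def Program.objective {n p : ℕ} (P : Program n p) (D : Decision n p) : ℝ :=
  1 / (1 - D.γ) *
    h2Norm (stack (fun k => CFC.sqrt P.Q * D.Φx k) (fun k => CFC.sqrt P.R * D.Φu k))

/-- Optimal solutions. -/
def Program.IsOptimal {n p : ℕ} (P : Program n p) (D : Decision n p) : Prop :=
  P.Feasible D ∧ ∀ D' : Decision n p, P.Feasible D' → P.objective D ≤ P.objective D'

end

end LQR

/-! Every estimate comes from one identity. If `Y = Φ + conv Y N`, that is `Y (I - N) = Φ`, and `N`
is small, then `Y` is controlled by `Φ`. If `N` has H∞ norm at most ν < 1, then the H₂ norm of `Y`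
is at most (1 - ν)⁻¹ times that of `Φ` (`l2Norm_le_of_eq_add_conv`). This is proved on initial
segments, so stability of `Y` is a conclusion and not an assumption. If instead the ℓ¹ norm of `N`
with weight r⁻ᵏ is at most 4/5, then `Y` inherits the decay rate r of `Φ` with a loss of a factor 5
(`norm_le_of_eq_add_conv`).

Write L = A + BK for the optimal closed loop and τ = Cx ρ^(F+1). On the estimated system, K produces
L + Δ with ‖Δ‖ ≤ ε(1 + ‖K‖), and the resolvent identity has the above form with N = Δ (zI - L)⁻¹, of
H∞ norm at most ζ. Hence the responses of K on the estimates decay at rate ρ. Cut off after F steps,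
they are feasible, with V = -(L + Δ)^F and γ ≤ 18ζ/5 (`feasible_staticDecision`). Their objective is
at most (1 + 20ζ) times the optimal H₂ norm (`objective_staticDecision_le`).

Conversely, a feasible Φ satisfies [zI - A, -B] Φ = I - N on the true system, where N collects -z⁻ᶠV
and the model error applied to Φ. The robust constraint gives ‖N‖ ≤ τ + (1 - τ)γ, and one minus this
bound is (1 - τ)(1 - γ). So the true H₂ norm is at most (1 - τ)⁻¹ times the objective
(`h2Norm_weighted_le`), and (1 - τ)⁻¹ ≤ 1 + C_J by the choice of F. The cost of an LTI controller is
the squared H₂ norm of its weighted closed loop (`hasLQRCost_lti`), and comparing an optimal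
solution with the truncated K gives (b).

An optimum exists because the feasible decisions with γ bounded away from 1 form a compact set,
while the objective is at least ‖Q^(1/2)‖_F / (1 - γ). When Q = 0 this bound is void, but then the
optimal cost is 0 and the truncated K attains objective 0. Part (c) is the weighted ℓ¹ form of the
main identity, applied to the same N. -/

namespace LQR

open Finset (range)
open Finset.HasAntidiagonal (antidiagonal)

/-! ### Spectral and Frobenius norms -/

section Norms

variable {𝕜 : Type*} [RCLike 𝕜] {l m n : Type*} [Fintype l] [Fintype m] [Fintype n]

/-- The squared Frobenius norm. -/
noncomputable def froSq (M : Matrix m n 𝕜) : ℝ := ∑ i, ∑ j, ‖M i j‖ ^ 2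

lemma froSq_nonneg (M : Matrix m n 𝕜) : 0 ≤ froSq M := by unfold froSq; positivity

lemma froSq_real (M : Matrix m n ℝ) : froSq M = ∑ i, ∑ j, M i j ^ 2 := by simp [froSq]

@[simp] lemma froSq_zero : froSq (0 : Matrix m n 𝕜) = 0 := by simp [froSq]

lemma sq_norm_le_froSq (M : Matrix m n 𝕜) (i : m) (j : n) : ‖M i j‖ ^ 2 ≤ froSq M := by
  refine le_trans ?_ (Finset.single_le_sum (f := fun i => ∑ j, ‖M i j‖ ^ 2)
    (fun i _ => by positivity) (Finset.mem_univ i))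
  exact Finset.single_le_sum (f := fun j => ‖M i j‖ ^ 2) (fun j _ => by positivity)
    (Finset.mem_univ j)

lemma froSq_eq_zero {M : Matrix m n 𝕜} (h : froSq M = 0) : M = 0 := by
  ext i j
  have := sq_norm_le_froSq M i j
  rw [h] at this
  simpa using le_antisymm this (by positivity)

variable [DecidableEq n]

lemma sum_sq_mulVec_le (M : Matrix m n 𝕜) (x : n → 𝕜) :
    ∑ i, ‖(M *ᵥ x) i‖ ^ 2 ≤ ‖M‖ ^ 2 * ∑ j, ‖x j‖ ^ 2 := by
  have h := Matrix.l2_opNorm_mulVec M (WithLp.toLp 2 x)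
  have h2 := pow_le_pow_left₀ (norm_nonneg _) h 2
  rw [mul_pow, EuclideanSpace.norm_sq_eq, EuclideanSpace.norm_sq_eq] at h2
  simpa using h2

lemma norm_le_of_sum_sq_mulVec_le {M : Matrix m n 𝕜} {c : ℝ} (hc : 0 ≤ c)
    (h : ∀ x : n → 𝕜, ∑ i, ‖(M *ᵥ x) i‖ ^ 2 ≤ c ^ 2 * ∑ j, ‖x j‖ ^ 2) : ‖M‖ ≤ c := by
  rw [Matrix.l2_opNorm_def]
  refine ContinuousLinearMap.opNorm_le_bound _ hc fun x => ?_
  refine (pow_le_pow_iff_left₀ (norm_nonneg _) (by positivity) two_ne_zero).1 ?_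
  rw [mul_pow, EuclideanSpace.norm_sq_eq, EuclideanSpace.norm_sq_eq]
  simpa using h x.ofLp

/-- Only an inequality, because the norm of the identity is 0 when the index type is empty. -/
lemma norm_one_le : ‖(1 : Matrix n n 𝕜)‖ ≤ 1 :=
  norm_le_of_sum_sq_mulVec_le zero_le_one fun x => by simp

lemma norm_fromRows_le {m₁ m₂ : Type*} [Fintype m₁] [Fintype m₂] (X : Matrix m₁ n 𝕜)
    (Y : Matrix m₂ n 𝕜) : ‖Matrix.fromRows X Y‖ ≤ ‖X‖ + ‖Y‖ := by
  refine norm_le_of_sum_sq_mulVec_le (by positivity) fun x => ?_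
  rw [Matrix.fromRows_mulVec, Fintype.sum_sum_type]
  have h1 := sum_sq_mulVec_le X x
  have h2 := sum_sq_mulVec_le Y x
  have h3 : 0 ≤ ∑ j, ‖x j‖ ^ 2 := by positivity
  have h4 : 0 ≤ ‖X‖ * ‖Y‖ * ∑ j, ‖x j‖ ^ 2 := by positivity
  simp only [Sum.elim_inl, Sum.elim_inr]
  nlinarith

/-- The source of the factor √2 in the robust constraint: the two blocks of model error sit side by
side. -/
lemma norm_fromCols_le {n₁ n₂ : Type*} [Fintype n₁] [Fintype n₂] [DecidableEq n₁]
    [DecidableEq n₂] {X : Matrix m n₁ 𝕜} {Y : Matrix m n₂ 𝕜} {c : ℝ} (hX : ‖X‖ ≤ c)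
    (hY : ‖Y‖ ≤ c) : ‖Matrix.fromCols X Y‖ ≤ Real.sqrt 2 * c := by
  have hc : 0 ≤ c := (norm_nonneg _).trans hX
  refine norm_le_of_sum_sq_mulVec_le (by positivity) fun x => ?_
  rw [Matrix.fromCols_mulVec, Fintype.sum_sum_type]
  have h1 := sum_sq_mulVec_le X (x ∘ Sum.inl)
  have h2 := sum_sq_mulVec_le Y (x ∘ Sum.inr)
  have e1 : ‖X‖ ^ 2 ≤ c ^ 2 := by gcongr
  have e2 : ‖Y‖ ^ 2 ≤ c ^ 2 := by gcongr
  have h3 : ∑ i, ‖(X *ᵥ (x ∘ Sum.inl) + Y *ᵥ (x ∘ Sum.inr)) i‖ ^ 2 ≤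
      2 * ∑ i, ‖(X *ᵥ (x ∘ Sum.inl)) i‖ ^ 2 + 2 * ∑ i, ‖(Y *ᵥ (x ∘ Sum.inr)) i‖ ^ 2 := by
    rw [Finset.mul_sum, Finset.mul_sum, ← Finset.sum_add_distrib]
    refine Finset.sum_le_sum fun i _ => ?_
    rw [Pi.add_apply]
    have := norm_add_le ((X *ᵥ (x ∘ Sum.inl)) i) ((Y *ᵥ (x ∘ Sum.inr)) i)
    have h4 := pow_le_pow_left₀ (norm_nonneg _) this 2
    nlinarith [sq_nonneg (‖(X *ᵥ (x ∘ Sum.inl)) i‖ - ‖(Y *ᵥ (x ∘ Sum.inr)) i‖)]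
  refine h3.trans ?_
  rw [mul_pow, Real.sq_sqrt (by norm_num)]
  have p1 : 0 ≤ ∑ j, ‖(x ∘ Sum.inl) j‖ ^ 2 := by positivity
  have p2 : 0 ≤ ∑ j, ‖(x ∘ Sum.inr) j‖ ^ 2 := by positivity
  have q1 := mul_le_mul_of_nonneg_right e1 p1
  have q2 := mul_le_mul_of_nonneg_right e2 p2
  simp only [Function.comp_apply] at *
  linarith

/-- A real matrix acts separately on the real and imaginary parts of a complex vector. -/
lemma norm_map_ofReal_le (M : Matrix m n ℝ) : ‖M.map (fun a : ℝ => (a : ℂ))‖ ≤ ‖M‖ := by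
  refine norm_le_of_sum_sq_mulVec_le (norm_nonneg _) fun x => ?_
  have h1 := sum_sq_mulVec_le M (fun j => (x j).re)
  have h2 := sum_sq_mulVec_le M (fun j => (x j).im)
  have e : ∀ i, ‖(M.map (fun a : ℝ => (a : ℂ)) *ᵥ x) i‖ ^ 2 =
      ‖(M *ᵥ fun j => (x j).re) i‖ ^ 2 + ‖(M *ᵥ fun j => (x j).im) i‖ ^ 2 := fun i => by
    rw [Complex.sq_norm, Complex.normSq_apply]
    simp [Matrix.mulVec, dotProduct, Complex.re_sum, Complex.im_sum]
    ring
  have e' : ∀ j, ‖x j‖ ^ 2 = ‖(x j).re‖ ^ 2 + ‖(x j).im‖ ^ 2 := fun j => by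
    rw [Complex.sq_norm, Complex.normSq_apply]; simp; ring
  simp only [e, e', Finset.sum_add_distrib, mul_add]
  exact add_le_add h1 h2

/-- Each row of the product is a row of `Y` acted on by `N`; the adjoint turns rows into columns. -/
lemma froSq_mul_le [DecidableEq l] (Y : Matrix m l 𝕜) (N : Matrix l n 𝕜) :
    froSq (Y * N) ≤ froSq Y * ‖N‖ ^ 2 := by
  unfold froSq
  rw [Finset.sum_mul]
  refine Finset.sum_le_sum fun i _ => ?_
  have h := sum_sq_mulVec_le Nᴴ (star (Y i))
  rw [Matrix.l2_opNorm_conjTranspose, ← Matrix.star_vecMul] at h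
  simp only [Pi.star_apply, norm_star] at h
  rw [mul_comm]
  exact h

lemma norm_entry_le (M : Matrix m n 𝕜) (i : m) (j : n) : ‖M i j‖ ≤ ‖M‖ := by
  have h := sum_sq_mulVec_le M (Pi.single j 1)
  have h2 : ∑ k, ‖(Pi.single j 1 : n → 𝕜) k‖ ^ 2 = 1 := by
    rw [Finset.sum_eq_single j] <;> simp +contextual
  rw [h2, mul_one] at h
  refine (pow_le_pow_iff_left₀ (norm_nonneg _) (norm_nonneg _) two_ne_zero).1 (le_trans ?_ h)
  refine le_trans (le_of_eq ?_) (Finset.single_le_sum (f := fun i =>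
    ‖(M *ᵥ Pi.single j 1) i‖ ^ 2) (fun i _ => by positivity) (Finset.mem_univ i))
  simp

end Norms

/-! ### Convolution of impulse responses -/

section Conv

variable {a b c d : Type*} [Fintype b]

/-- The product of transfer matrices: convolution of the impulse responses. -/
def conv {R : Type*} [NonUnitalNonAssocSemiring R] (M : ℕ → Matrix a b R) (N : ℕ → Matrix b c R) :
    ℕ → Matrix a c R :=
  fun k => ∑ ij ∈ antidiagonal k, M ij.1 * N ij.2

lemma conv_apply {R : Type*} [NonUnitalNonAssocSemiring R] (M : ℕ → Matrix a b R)
    (N : ℕ → Matrix b c R) (k : ℕ) : conv M N k = ∑ ij ∈ antidiagonal k, M ij.1 * N ij.2 := rfl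

lemma conv_assoc [Fintype c] {R : Type*} [NonUnitalSemiring R] (M : ℕ → Matrix a b R) (N : ℕ → Matrix b c R)
    (P : ℕ → Matrix c d R) : conv (conv M N) P = conv M (conv N P) := by
  funext k
  simp only [conv_apply, Matrix.sum_mul, Matrix.mul_sum, Finset.sum_sigma']
  refine Finset.sum_nbij' (fun x => ⟨(x.2.1, x.2.2 + x.1.2), (x.2.2, x.1.2)⟩)
    (fun x => ⟨(x.1.1 + x.2.1, x.2.2), (x.1.1, x.2.1)⟩) ?_ ?_ ?_ ?_ ?_
  all_goals
    rintro ⟨⟨i, j⟩, ⟨i', j'⟩⟩ h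
    simp only [Finset.mem_sigma, Finset.HasAntidiagonal.mem_antidiagonal] at h ⊢
  · exact ⟨by omega, trivial⟩
  · exact ⟨by omega, trivial⟩
  · obtain ⟨h1, rfl⟩ := h; rfl
  · obtain ⟨h1, rfl⟩ := h; rfl
  · rw [Matrix.mul_assoc]

lemma conv_succ_left {R : Type*} [NonUnitalNonAssocSemiring R] {M : ℕ → Matrix a b R}
    (hM : M 0 = 0) (N : ℕ → Matrix b c R) (k : ℕ) :
    conv M N (k + 1) = conv (fun i => M (i + 1)) N k := by
  rw [conv_apply, Finset.Nat.sum_antidiagonal_succ]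
  simp [hM, conv_apply]

lemma conv_zero_left_apply {R : Type*} [NonUnitalNonAssocSemiring R] {M : ℕ → Matrix a b R}
    (hM : M 0 = 0) (N : ℕ → Matrix b c R) : conv M N 0 = 0 := by simp [conv_apply, hM]

lemma conv_add_left {R : Type*} [NonUnitalNonAssocSemiring R] (M M' : ℕ → Matrix a b R)
    (N : ℕ → Matrix b c R) : conv (M + M') N = conv M N + conv M' N := by
  funext k; simp [conv_apply, Matrix.add_mul, Finset.sum_add_distrib]

lemma conv_add_right {R : Type*} [NonUnitalNonAssocSemiring R] (M : ℕ → Matrix a b R)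
    (N N' : ℕ → Matrix b c R) : conv M (N + N') = conv M N + conv M N' := by
  funext k; simp [conv_apply, Matrix.mul_add, Finset.sum_add_distrib]

lemma mul_conv [Fintype c] {R : Type*} [NonUnitalSemiring R] (W : Matrix a b R) (M : ℕ → Matrix b c R)
    (N : ℕ → Matrix c d R) : conv (fun k => W * M k) N = fun k => W * conv M N k := by
  funext k; simp [conv_apply, Matrix.mul_sum, Matrix.mul_assoc]

/-- The identity transfer matrix. -/
def delta {a : Type*} [DecidableEq a] : ℕ → Matrix a a ℝ := fun k => if k = 0 then 1 else 0

lemma conv_delta [DecidableEq b] (M : ℕ → Matrix a b ℝ) : conv M delta = M := by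
  funext k
  rw [conv_apply, Finset.sum_eq_single (k, 0)]
  · simp [delta]
  · rintro ⟨i, j⟩ h h'
    have : j ≠ 0 := by rintro rfl; simp at h; simp [h] at h'
    simp [delta, this]
  · simp

end Conv

/-! ### Values on the unit circle -/

section Eval

variable {a b c : Type*} [Fintype a] [Fintype b] [Fintype c] [DecidableEq b] [DecidableEq c]

lemma norm_inv_circle_pow (z : Circle) (k : ℕ) : ‖((z : ℂ)⁻¹) ^ k‖ = 1 := by
  simp [Circle.norm_coe]

lemma summable_eval {M : TransferMatrix a b} (hM : Summable fun k => ‖M k‖) (z : Circle) :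
    Summable fun k => ‖((z : ℂ)⁻¹ ^ k) • (M k).map (fun a : ℝ => (a : ℂ))‖ := by
  refine Summable.of_nonneg_of_le (fun k => norm_nonneg _) (fun k => ?_) hM
  rw [norm_smul, norm_inv_circle_pow, one_mul]
  exact norm_map_ofReal_le _

lemma norm_eval_le {M : TransferMatrix a b} (hM : Summable fun k => ‖M k‖) (z : Circle) :
    ‖TransferMatrix.eval M z‖ ≤ ∑' k, ‖M k‖ := by
  refine (norm_tsum_le_tsum_norm (summable_eval hM z)).trans ?_
  refine (summable_eval hM z).tsum_le_tsum (fun k => ?_) hM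
  rw [norm_smul, norm_inv_circle_pow, one_mul]
  exact norm_map_ofReal_le _

lemma norm_eval_le_hinfNorm {M : TransferMatrix a b} (hM : Summable fun k => ‖M k‖) (z : Circle) :
    ‖TransferMatrix.eval M z‖ ≤ hinfNorm M :=
  le_ciSup (f := fun z : Circle => ‖TransferMatrix.eval M (z : ℂ)‖)
    ⟨_, by rintro _ ⟨z, rfl⟩; exact norm_eval_le hM z⟩ z

omit [Fintype a] [Fintype b] [DecidableEq b] in
lemma hinfNorm_nonneg {a b : Type*} [Fintype a] [Fintype b] [DecidableEq b]
    (M : TransferMatrix a b) : 0 ≤ hinfNorm M :=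
  Real.iSup_nonneg fun _ => norm_nonneg _

lemma hinfNorm_le {M : TransferMatrix a b} {C : ℝ}
    (h : ∀ z : Circle, ‖TransferMatrix.eval M z‖ ≤ C) : hinfNorm M ≤ C :=
  ciSup_le h

lemma hasSum_eval_apply {M : TransferMatrix a b} (hM : Summable fun k => ‖M k‖) (z : Circle)
    (i : a) (j : b) :
    HasSum (fun k => ((z : ℂ)⁻¹ ^ k) * (M k i j : ℂ)) (TransferMatrix.eval M z i j) := by
  have h := (summable_eval hM z).of_norm.hasSum
  have h2 := Pi.hasSum.1 (Pi.hasSum.1 h i) j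
  simpa [TransferMatrix.eval] using h2

lemma summable_norm_apply {M : TransferMatrix a b} (hM : Summable fun k => ‖M k‖) (z : Circle)
    (i : a) (j : b) : Summable fun k => ‖((z : ℂ)⁻¹ ^ k) * (M k i j : ℂ)‖ := by
  refine Summable.of_nonneg_of_le (fun k => norm_nonneg _) (fun k => ?_) hM
  rw [norm_mul, norm_inv_circle_pow, one_mul, Complex.norm_real]
  exact norm_entry_le _ i j

lemma eval_conv {M : TransferMatrix a b} {N : TransferMatrix b c} (hM : Summable fun k => ‖M k‖)
    (hN : Summable fun k => ‖N k‖) (hMN : Summable fun k => ‖conv M N k‖) (z : Circle) :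
    TransferMatrix.eval (conv M N) z = TransferMatrix.eval M z * TransferMatrix.eval N z := by
  ext i j
  rw [← (hasSum_eval_apply hMN z i j).tsum_eq, Matrix.mul_apply]
  simp only [← (hasSum_eval_apply hM z _ _).tsum_eq, ← (hasSum_eval_apply hN z _ _).tsum_eq,
    tsum_mul_tsum_eq_tsum_sum_antidiagonal_of_summable_norm (summable_norm_apply hM z _ _)
      (summable_norm_apply hN z _ _)]
  rw [← Summable.tsum_finsetSum fun l _ => ?_]
  · congr 1
    funext k
    rw [conv_apply, Finset.sum_comm, Matrix.sum_apply, Complex.ofReal_sum, Finset.mul_sum]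
    refine Finset.sum_congr rfl fun x hx => ?_
    rw [Matrix.mul_apply, Complex.ofReal_sum, Finset.mul_sum]
    refine Finset.sum_congr rfl fun l _ => ?_
    rw [← Finset.HasAntidiagonal.mem_antidiagonal.1 hx, pow_add]
    push_cast
    ring
  · exact (summable_norm_sum_mul_antidiagonal_of_summable_norm (summable_norm_apply hM z _ _)
      (summable_norm_apply hN z _ _)).of_norm

omit [Fintype a] in
lemma summable_norm_of_fir {a : Type*} [Fintype a] {M : TransferMatrix a b} {T : ℕ}
    (h : ∀ k, T ≤ k → M k = 0) : Summable fun k => ‖M k‖ :=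
  summable_of_ne_finset_zero (s := range T) fun k hk => by
    rw [h k (by simpa using hk), norm_zero]

omit [Fintype a] [Fintype b] [DecidableEq b] in
lemma eval_fir {a b : Type*} {M : TransferMatrix a b} {T : ℕ} (h : ∀ k, T ≤ k → M k = 0) (z : ℂ) :
    TransferMatrix.eval M z = ∑ k ∈ range T, (z⁻¹ ^ k) • (M k).map (fun a : ℝ => (a : ℂ)) :=
  tsum_eq_sum fun k hk => by
    rw [h k (by simpa using hk)]
    ext; simp

omit [Fintype a] [Fintype c] [DecidableEq b] [DecidableEq c] in
lemma conv_fir {M : TransferMatrix a b} {N : TransferMatrix b c} {T T' : ℕ}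
    (hM : ∀ k, T ≤ k → M k = 0) (hN : ∀ k, T' ≤ k → N k = 0) (k : ℕ) (hk : T + T' ≤ k) :
    conv M N k = 0 := by
  rw [conv_apply]
  refine Finset.sum_eq_zero fun x hx => ?_
  have := Finset.HasAntidiagonal.mem_antidiagonal.1 hx
  rcases le_or_gt T x.1 with h | h
  · rw [hM _ h, Matrix.zero_mul]
  · rw [hN _ (by omega), Matrix.mul_zero]

end Eval

/-! ### Parseval's identity over the roots of unity -/

section Parseval

lemma sum_pow_mul_inv_pow {N : ℕ} {ω : ℂ} (hω : IsPrimitiveRoot ω N) {k l : ℕ} (hk : k < N)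
    (hl : l < N) : ∑ t ∈ range N, (ω ^ t) ^ k * ((ω ^ t) ^ l)⁻¹ = if k = l then (N : ℂ) else 0 := by
  have hω0 : ω ≠ 0 := hω.ne_zero (by omega)
  split_ifs with h
  · subst h
    simp [hω0]
  · have e : ∀ t, (ω ^ t) ^ k * ((ω ^ t) ^ l)⁻¹ = (ω ^ k * (ω ^ l)⁻¹) ^ t := fun t => by
      rw [mul_pow, inv_pow, ← pow_mul, ← pow_mul, ← pow_mul, ← pow_mul, mul_comm t, mul_comm t]
    simp only [e]
    have hne : ω ^ k * (ω ^ l)⁻¹ ≠ 1 := by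
      intro h1
      rw [mul_inv_eq_one₀ (pow_ne_zero _ hω0)] at h1
      exact h (hω.pow_inj hk hl h1)
    have h1 : (ω ^ k * (ω ^ l)⁻¹) ^ N = 1 := by
      rw [mul_pow, inv_pow, ← pow_mul, ← pow_mul, mul_comm k, mul_comm l, pow_mul, pow_mul,
        hω.pow_eq_one]
      simp
    have := geom_sum_mul (ω ^ k * (ω ^ l)⁻¹) N
    rw [h1, sub_self] at this
    exact (mul_eq_zero.1 this).resolve_right (sub_ne_zero.2 hne)

/-- Parseval for the discrete Fourier transform. For responses of length at most `N`, averaging over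
the `N`-th roots of unity replaces the integral over the circle. -/
lemma sum_sq_norm_dft {N : ℕ} {ω : ℂ} (hω : IsPrimitiveRoot ω N) (hN : N ≠ 0) (f : ℕ → ℂ) :
    ∑ t ∈ range N, ‖∑ k ∈ range N, (ω ^ t) ^ k * f k‖ ^ 2 = N * ∑ k ∈ range N, ‖f k‖ ^ 2 := by
  have hn : ‖ω‖ = 1 := hω.norm'_eq_one hN
  have hc : ∀ t k, (starRingEnd ℂ) ((ω ^ t) ^ k) = ((ω ^ t) ^ k)⁻¹ := fun t k => by
    rw [Complex.inv_eq_conj (by simp [hn])]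
  apply Complex.ofReal_injective
  push_cast
  simp only [← Complex.mul_conj', map_sum, map_mul, hc, Finset.sum_mul_sum]
  rw [Finset.sum_comm]
  rw [Finset.mul_sum]
  refine Finset.sum_congr rfl fun k hk => ?_
  rw [Finset.sum_comm]
  have e : ∀ l ∈ range N, ∑ t ∈ range N, (ω ^ t) ^ k * f k * (((ω ^ t) ^ l)⁻¹ *
      (starRingEnd ℂ) (f l)) = (if k = l then (N : ℂ) else 0) * (f k * (starRingEnd ℂ) (f l)) :=
    fun l hl => by
      rw [← sum_pow_mul_inv_pow hω (Finset.mem_range.1 hk) (Finset.mem_range.1 hl), Finset.sum_mul]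
      exact Finset.sum_congr rfl fun t _ => by ring
  rw [Finset.sum_congr rfl e, Finset.sum_eq_single k]
  · simp
  · intro l _ h; simp [Ne.symm h]
  · intro h; exact absurd hk h

variable {a b c : Type*} [Fintype a] [Fintype b] [Fintype c] [DecidableEq b] [DecidableEq c]

omit [DecidableEq b] in
lemma sum_froSq_eval {N : ℕ} (hN : N ≠ 0) {M : TransferMatrix a b} (hM : ∀ k, N ≤ k → M k = 0)
    {z : Circle} (hz : IsPrimitiveRoot (z : ℂ)⁻¹ N) :
    ∑ t ∈ range N, froSq (TransferMatrix.eval M ((z ^ t : Circle) : ℂ)) =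
      N * ∑ k ∈ range N, froSq (M k) := by
  have e : ∀ t, froSq (TransferMatrix.eval M ((z ^ t : Circle) : ℂ)) =
      ∑ i, ∑ j, ‖∑ k ∈ range N, (((z : ℂ)⁻¹) ^ t) ^ k * (M k i j : ℂ)‖ ^ 2 := fun t => by
    rw [eval_fir hM]
    simp [froSq, Matrix.sum_apply]
  simp only [e]
  rw [Finset.sum_comm]
  have e2 : ∀ k, froSq (M k) = ∑ i, ∑ j, ‖(M k i j : ℂ)‖ ^ 2 := fun k => by simp [froSq]
  simp only [e2]
  rw [Finset.sum_comm (s := range N), Finset.mul_sum]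
  refine Finset.sum_congr rfl fun i _ => ?_
  rw [Finset.sum_comm, Finset.sum_comm (s := range N), Finset.mul_sum]
  exact Finset.sum_congr rfl fun j _ => sum_sq_norm_dft hz hN _

/-- At each root of unity the value of the product is the product of the values, so the bound on
‖N(z)‖ applies pointwise; Parseval on both sides transfers it to the coefficients. -/
lemma sum_froSq_conv_le_of_fir {Y : TransferMatrix a b} {N : TransferMatrix b c} {T T' : ℕ} {ν : ℝ}
    (hY : ∀ k, T ≤ k → Y k = 0) (hN : ∀ k, T' ≤ k → N k = 0)
    (hν : ∀ z : Circle, ‖TransferMatrix.eval N z‖ ≤ ν) :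
    ∑ k ∈ range (T + T'), froSq (conv Y N k) ≤ ν ^ 2 * ∑ k ∈ range T, froSq (Y k) := by
  rcases Nat.eq_zero_or_pos T with rfl | hT
  · refine le_trans (le_of_eq (Finset.sum_eq_zero fun k _ => ?_)) (by simp)
    have : conv Y N k = 0 := by
      rw [conv_apply]
      exact Finset.sum_eq_zero fun x _ => by rw [hY _ (by omega), Matrix.zero_mul]
    rw [this, froSq_zero]
  -- With `T + T'` sample points the convolution does not wrap around, so Parseval is exact for it.
  set P := T + T' with hP
  have hP0 : P ≠ 0 := by omega
  obtain ⟨ω, hω⟩ : ∃ ω : ℂ, IsPrimitiveRoot ω P := ⟨_, Complex.isPrimitiveRoot_exp P hP0⟩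
  have hnorm := hω.norm'_eq_one hP0
  let z : Circle := ⟨ω⁻¹, by simp [Submonoid.unitSphere, hnorm]⟩
  have hz : IsPrimitiveRoot (z : ℂ)⁻¹ P := by simpa [z] using hω
  have hYP : ∀ k, P ≤ k → Y k = 0 := fun k hk => hY k (by omega)
  have h1 := sum_froSq_eval hP0 (conv_fir hY hN) hz
  have h2 := sum_froSq_eval hP0 hYP hz
  have hle : ∑ t ∈ range P, froSq (TransferMatrix.eval (conv Y N) ((z ^ t : Circle) : ℂ)) ≤
      ν ^ 2 * ∑ t ∈ range P, froSq (TransferMatrix.eval Y ((z ^ t : Circle) : ℂ)) := by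
    rw [Finset.mul_sum]
    refine Finset.sum_le_sum fun t _ => ?_
    rw [eval_conv (summable_norm_of_fir hY) (summable_norm_of_fir hN)
      (summable_norm_of_fir (conv_fir hY hN)), mul_comm]
    refine (froSq_mul_le _ _).trans ?_
    exact mul_le_mul_of_nonneg_left (pow_le_pow_left₀ (norm_nonneg _) (hν _) 2) (froSq_nonneg _)
  rw [h1, h2] at hle
  have h3 : ∑ k ∈ range P, froSq (Y k) = ∑ k ∈ range T, froSq (Y k) := by
    symm
    refine Finset.sum_subset (Finset.range_subset_range.2 (by omega)) fun k _ hk => ?_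
    rw [hY k (by simpa using hk), froSq_zero]
  rw [h3] at hle
  have hPpos : (0 : ℝ) < P := by positivity
  exact le_of_mul_le_mul_left (by linarith) hPpos

end Parseval

/-! ### Convolution on `ℓ²` -/

section L2

variable {a b c : Type*} [Fintype a] [Fintype b] [Fintype c] [DecidableEq b] [DecidableEq c]

/-- Truncation of an impulse response to its first `T` coefficients. -/
def trunc {m n : Type*} (T : ℕ) (M : TransferMatrix m n) : TransferMatrix m n :=
  fun k => if k < T then M k else 0

lemma trunc_of_le {m n : Type*} {T : ℕ} (M : TransferMatrix m n) (k : ℕ) (hk : T ≤ k) :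
    trunc T M k = 0 := if_neg (by omega)

lemma trunc_of_lt {m n : Type*} {T k : ℕ} (M : TransferMatrix m n) (hk : k < T) :
    trunc T M k = M k := if_pos hk

omit [DecidableEq b] in
lemma norm_eval_trunc_le {N : TransferMatrix b c} (hN : Summable fun k => ‖N k‖) (T : ℕ)
    (z : Circle) : ‖TransferMatrix.eval (trunc T N) z‖ ≤
      ‖TransferMatrix.eval N z‖ + ∑' k, ‖N (k + T)‖ := by
  have hs := summable_eval hN z
  have h1 : TransferMatrix.eval (trunc T N) z =
      ∑ k ∈ range T, ((z : ℂ)⁻¹ ^ k) • (N k).map (fun a : ℝ => (a : ℂ)) := by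
    rw [eval_fir (trunc_of_le N)]
    exact Finset.sum_congr rfl fun k hk => by rw [trunc_of_lt N (Finset.mem_range.1 hk)]
  have h2 := hs.of_norm.sum_add_tsum_nat_add T
  have h3 : TransferMatrix.eval (trunc T N) z = TransferMatrix.eval N z -
      ∑' k, ((z : ℂ)⁻¹ ^ (k + T)) • (N (k + T)).map (fun a : ℝ => (a : ℂ)) := by
    rw [h1, eq_sub_iff_add_eq]
    exact h2
  rw [h3]
  refine (norm_sub_le _ _).trans (add_le_add le_rfl ?_)
  have hs' := (summable_nat_add_iff T).2 hs
  refine (norm_tsum_le_tsum_norm hs').trans ?_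
  refine hs'.tsum_le_tsum (fun k => ?_) ((summable_nat_add_iff T).2 hN)
  rw [norm_smul, norm_inv_circle_pow, one_mul]
  exact norm_map_ofReal_le _

omit [Fintype a] [Fintype c] [DecidableEq b] [DecidableEq c] in
lemma conv_congr {M M' : TransferMatrix a b} {N N' : TransferMatrix b c} {k : ℕ}
    (hM : ∀ i ≤ k, M i = M' i) (hN : ∀ i ≤ k, N i = N' i) : conv M N k = conv M' N' k := by
  simp only [conv_apply]
  refine Finset.sum_congr rfl fun x hx => ?_
  have := Finset.HasAntidiagonal.mem_antidiagonal.1 hx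
  rw [hM _ (by omega), hN _ (by omega)]

/-- No summability of `Y` is needed: the first `T` coefficients of the product involve only those of
`Y` and `N` up to `T`. Cutting `N` at `m ≥ T` raises its H∞ norm by at most its ℓ¹ tail, which
vanishes as `m` grows. -/
lemma sum_froSq_conv_le (Y : TransferMatrix a b) {N : TransferMatrix b c}
    (hN : Summable fun k => ‖N k‖) {ν : ℝ} (hν : ∀ z : Circle, ‖TransferMatrix.eval N z‖ ≤ ν)
    (T : ℕ) :
    ∑ k ∈ range T, froSq (conv Y N k) ≤ ν ^ 2 * ∑ k ∈ range T, froSq (Y k) := by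
  have hm : ∀ m ≥ T, ∑ k ∈ range T, froSq (conv Y N k) ≤
      (ν + ∑' k, ‖N (k + m)‖) ^ 2 * ∑ k ∈ range T, froSq (Y k) := by
    intro m hm
    have h := sum_froSq_conv_le_of_fir (trunc_of_le (T := T) Y) (trunc_of_le (T := m) N)
      (fun z => (norm_eval_trunc_le hN m z).trans (add_le_add (hν z) le_rfl))
    have e1 : ∑ k ∈ range T, froSq (trunc T Y k) = ∑ k ∈ range T, froSq (Y k) :=
      Finset.sum_congr rfl fun k hk => by rw [trunc_of_lt Y (Finset.mem_range.1 hk)]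
    rw [e1] at h
    refine le_trans ?_ h
    have e2 : ∑ k ∈ range T, froSq (conv Y N k) =
        ∑ k ∈ range T, froSq (conv (trunc T Y) (trunc m N) k) := by
      refine Finset.sum_congr rfl fun k hk => ?_
      have hk' := Finset.mem_range.1 hk
      exact congrArg froSq (conv_congr (fun i hi => (trunc_of_lt Y (hi.trans_lt hk')).symm)
        (fun i hi => (trunc_of_lt N (hi.trans_lt (hk'.trans_le hm))).symm))
    rw [e2]
    exact Finset.sum_le_sum_of_subset_of_nonneg (Finset.range_subset_range.2 (by omega))
      fun _ _ _ => froSq_nonneg _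
  have hlim : Tendsto (fun m => (ν + ∑' k, ‖N (k + m)‖) ^ 2 * ∑ k ∈ range T, froSq (Y k)) atTop
      (𝓝 ((ν + 0) ^ 2 * ∑ k ∈ range T, froSq (Y k))) :=
    (((tendsto_sum_nat_add fun k => ‖N k‖).const_add ν).pow 2).mul_const _
  rw [add_zero] at hlim
  exact ge_of_tendsto hlim (eventually_atTop.2 ⟨T, hm⟩)

/-- The `ℓ²` norm of the first `T` coefficients. -/
noncomputable def l2Norm {m n : Type*} [Fintype m] [Fintype n] (T : ℕ)
    (M : TransferMatrix m n) : ℝ :=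
  Real.sqrt (∑ k ∈ range T, froSq (M k))

lemma l2Norm_nonneg {m n : Type*} [Fintype m] [Fintype n] (T : ℕ) (M : TransferMatrix m n) :
    0 ≤ l2Norm T M := Real.sqrt_nonneg _

omit [Fintype b] [DecidableEq b] in
lemma l2Norm_add_le {a b : Type*} [Fintype a] [Fintype b] (T : ℕ) (M N : TransferMatrix a b) :
    l2Norm T (M + N) ≤ l2Norm T M + l2Norm T N := by
  let f : TransferMatrix a b → EuclideanSpace ℝ (Fin T × a × b) :=
    fun M => WithLp.toLp 2 fun x => M x.1 x.2.1 x.2.2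
  have e : ∀ M, l2Norm T M = ‖f M‖ := fun M => by
    rw [EuclideanSpace.norm_eq, l2Norm]
    simp only [f, Fintype.sum_prod_type, froSq]
    rw [← Fin.sum_univ_eq_sum_range (fun k => ∑ i, ∑ j, ‖M k i j‖ ^ 2) T]
  rw [e, e, e]
  exact norm_add_le (f M) (f N)

/-- If `Y (I - N) = Φ` and `‖N‖_{H_∞} ≤ ν < 1`, then `‖Y‖_{ℓ²} ≤ (1 - ν)⁻¹ ‖Φ‖_{ℓ²}`, on each
initial segment. -/
lemma l2Norm_le_of_eq_add_conv {Y Φ : TransferMatrix a b} {N : TransferMatrix b b}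
    (hY : Y = Φ + conv Y N) (hN : Summable fun k => ‖N k‖) {ν : ℝ}
    (hν : ∀ z : Circle, ‖TransferMatrix.eval N z‖ ≤ ν) (hν1 : ν < 1) (T : ℕ) :
    l2Norm T Y ≤ 1 / (1 - ν) * l2Norm T Φ := by
  have hν0 : 0 ≤ ν := (norm_nonneg _).trans (hν 1)
  have h1 : l2Norm T (conv Y N) ≤ ν * l2Norm T Y := by
    rw [l2Norm, l2Norm, ← Real.sqrt_sq hν0, ← Real.sqrt_mul (sq_nonneg _)]
    exact Real.sqrt_le_sqrt (sum_froSq_conv_le Y hN hν T)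
  -- The term `ν * l2Norm T Y` can be absorbed on the left since a truncated norm is finite for any
  -- `Y`.
  have h2 : l2Norm T Y ≤ l2Norm T Φ + ν * l2Norm T Y := by
    conv_lhs => rw [hY]
    exact (l2Norm_add_le _ _ _).trans (add_le_add le_rfl h1)
  rw [one_div, ← div_eq_inv_mul, le_div_iff₀ (by linarith)]
  linarith

/-! ### The `H₂` norm -/

variable {m n : Type*} [Fintype m] [Fintype n]

/-- Square-summability of an impulse response. -/
def IsL2 (M : TransferMatrix m n) : Prop := Summable fun k => froSq (M k)

lemma h2Norm_eq (M : TransferMatrix m n) : h2Norm M = Real.sqrt (∑' k, froSq (M k)) := by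
  simp only [h2Norm, froSq_real]

lemma h2Norm_nonneg (M : TransferMatrix m n) : 0 ≤ h2Norm M := Real.sqrt_nonneg _

lemma h2Norm_sq (M : TransferMatrix m n) : h2Norm M ^ 2 = ∑' k, froSq (M k) := by
  rw [h2Norm_eq, Real.sq_sqrt (tsum_nonneg fun _ => froSq_nonneg _)]

lemma l2Norm_le_h2Norm {M : TransferMatrix m n} (hM : IsL2 M) (T : ℕ) :
    l2Norm T M ≤ h2Norm M := by
  rw [h2Norm_eq]
  exact Real.sqrt_le_sqrt (hM.sum_le_tsum _ fun _ _ => froSq_nonneg _)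

lemma isL2_of_l2Norm_le {M : TransferMatrix m n} {C : ℝ} (h : ∀ T, l2Norm T M ≤ C) :
    IsL2 M ∧ h2Norm M ≤ C := by
  have hC : 0 ≤ C := (l2Norm_nonneg 0 M).trans (h 0)
  have h1 : ∀ T, ∑ k ∈ range T, froSq (M k) ≤ C ^ 2 := fun T => by
    rw [← Real.sqrt_le_left hC]; exact h T
  refine ⟨summable_of_sum_range_le (fun _ => froSq_nonneg _) h1, ?_⟩
  rw [h2Norm_eq, Real.sqrt_le_left hC]
  exact Real.tsum_le_of_sum_range_le (fun _ => froSq_nonneg _) h1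

lemma isL2_of_fir {M : TransferMatrix m n} {T : ℕ} (h : ∀ k, T ≤ k → M k = 0) : IsL2 M :=
  summable_of_ne_finset_zero (s := range T) fun k hk => by
    rw [h k (by simpa using hk), froSq_zero]

/-- The bound on initial segments is uniform in `T`, so square-summability of `Y` comes with it. -/
lemma h2Norm_le_of_eq_add_conv {Y Φ : TransferMatrix a b} {N : TransferMatrix b b}
    (hY : Y = Φ + conv Y N) (hN : Summable fun k => ‖N k‖) {ν : ℝ}
    (hν : ∀ z : Circle, ‖TransferMatrix.eval N z‖ ≤ ν) (hν1 : ν < 1) (hΦ : IsL2 Φ) :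
    IsL2 Y ∧ h2Norm Y ≤ 1 / (1 - ν) * h2Norm Φ :=
  isL2_of_l2Norm_le fun T => (l2Norm_le_of_eq_add_conv hY hN hν hν1 T).trans
    (mul_le_mul_of_nonneg_left (l2Norm_le_h2Norm hΦ T) (by
      rw [one_div, inv_nonneg]; linarith))

lemma h2Norm_trunc_le {M : TransferMatrix m n} (hM : IsL2 M) (T : ℕ) :
    h2Norm (trunc T M) ≤ h2Norm M := by
  rw [h2Norm_eq, h2Norm_eq]
  refine Real.sqrt_le_sqrt ((isL2_of_fir (trunc_of_le M)).tsum_le_tsum (fun k => ?_) hM)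
  unfold trunc
  split_ifs
  · rfl
  · simpa using froSq_nonneg _

end L2

/-! ### Closed-loop responses -/

section Response

variable {n p : ℕ} {c : Type*}

lemma conv_succ_right {a b c R : Type*} [Fintype b] [NonUnitalNonAssocSemiring R]
    (M : ℕ → Matrix a b R) {N : ℕ → Matrix b c R} (hN : N 0 = 0) (k : ℕ) :
    conv M N (k + 1) = conv M (fun i => N (i + 1)) k := by
  rw [conv_apply, Finset.Nat.sum_antidiagonal_succ']
  simp [hN, conv_apply]

lemma conv_zero_right_apply {a b c R : Type*} [Fintype b] [NonUnitalNonAssocSemiring R]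
    (M : ℕ → Matrix a b R) {N : ℕ → Matrix b c R} (hN : N 0 = 0) : conv M N 0 = 0 := by
  simp [conv_apply, hN]

lemma delta_conv {a b : Type*} [Fintype a] [DecidableEq a] (M : ℕ → Matrix a b ℝ) :
    conv delta M = M := by
  funext k
  rw [conv_apply, Finset.sum_eq_single (0, k)]
  · simp [delta]
  · rintro ⟨i, j⟩ h h'
    have : i ≠ 0 := by rintro rfl; simp at h; simp [h] at h'
    simp [delta, this]
  · simp

variable (A : Matrix (Fin n) (Fin n) ℝ) (B : Matrix (Fin n) (Fin p) ℝ)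
  (K : TransferMatrix (Fin p) (Fin n))

lemma responseU_eq_conv : responseU A B K = conv K (responseX A B K) := rfl

/-- Coefficients of S = 1 + z⁻¹ G S, where S is the power series inverse that defines the response.
Later arguments use this recursion rather than the inverse. -/
lemma responseX_succ (k : ℕ) : responseX A B K (k + 1) =
    A * responseX A B K k + B * responseU A B K k + delta k := by
  set G : PowerSeries (Matrix (Fin n) (Fin n) ℝ) :=
    PowerSeries.mk fun l => const A l + B * K l with hG
  set S := PowerSeries.invOfUnit (1 - PowerSeries.X * G) 1 with hS
  have h1 : (1 - PowerSeries.X * G) * S = 1 := PowerSeries.mul_invOfUnit _ _ (by simp)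
  have h2 : S = 1 + PowerSeries.X * (G * S) := by
    rw [sub_mul, one_mul, sub_eq_iff_eq_add, mul_assoc] at h1
    exact h1
  have e : ∀ k, responseX A B K (k + 1) = PowerSeries.coeff k S := fun k => rfl
  rw [e, h2, responseU_eq_conv]
  cases k with
  | zero => simp [responseX, delta, conv_apply]
  | succ k =>
    rw [conv_succ_right _ rfl]
    simp only [e]
    rw [map_add, PowerSeries.coeff_succ_X_mul, PowerSeries.coeff_mul]
    have h3 : ∑ x ∈ antidiagonal k, const A x.1 * PowerSeries.coeff x.2 S =
        A * PowerSeries.coeff k S := by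
      rw [Finset.sum_eq_single (0, k)]
      · simp [const]
      · rintro ⟨i, j⟩ h h'
        have : i ≠ 0 := by rintro rfl; simp at h; simp [h] at h'
        simp [const, this]
      · simp
    simp [hG, PowerSeries.coeff_mk, add_mul, Finset.sum_add_distrib, h3, conv_apply,
      Matrix.mul_sum, Matrix.mul_assoc, delta, PowerSeries.coeff_one]

/-- The closed loop with disturbance `f` has state `responseX * f`. -/
lemma eq_conv_responseX {X f : ℕ → Matrix (Fin n) c ℝ} (h0 : X 0 = 0)
    (hX : ∀ k, X (k + 1) = A * X k + B * conv K X k + f k) : X = conv (responseX A B K) f := by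
  -- The claim covers all earlier times because the dynamic controller feeds back the whole past of
  -- `X`.
  have h1 : ∀ k, ∀ i ≤ k, X i = conv (responseX A B K) f i := by
    intro k
    induction k with
    | zero =>
      intro i hi
      obtain rfl : i = 0 := by omega
      rw [h0, conv_zero_left_apply rfl]
    | succ k ih =>
      intro i hi
      rcases Nat.lt_or_ge i (k + 1) with h | h
      · exact ih i (by omega)
      obtain rfl : i = k + 1 := by omega
      rw [hX, conv_succ_left rfl, conv_congr (fun _ _ => rfl) ih, ih k le_rfl,
        show (fun i => responseX A B K (i + 1)) = (fun k => A * responseX A B K k) +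
          (fun k => B * responseU A B K k) + delta from funext fun k => responseX_succ A B K k,
        conv_add_left, conv_add_left, mul_conv, mul_conv, delta_conv, responseU_eq_conv,
        ← conv_assoc]
      rfl
  exact funext fun k => h1 k k le_rfl

lemma const_conv {a b : Type*} [Fintype b] (K : Matrix a b ℝ) (M : ℕ → Matrix b c ℝ) :
    conv (const K) M = fun k => K * M k := by
  funext k
  rw [conv_apply, Finset.sum_eq_single (0, k)]
  · simp [const]
  · rintro ⟨i, j⟩ h h'
    have : i ≠ 0 := by rintro rfl; simp at h; simp [h] at h'
    simp [const, this]
  · simp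

lemma res_succ (M : Matrix (Fin n) (Fin n) ℝ) (k : ℕ) : res M (k + 1) = M * res M k + delta k := by
  cases k with
  | zero => simp [res, delta]
  | succ k => simp [res, delta, pow_succ']

lemma responseX_const (K : Matrix (Fin p) (Fin n) ℝ) :
    responseX A B (const K) = res (A + B * K) := by
  have h := eq_conv_responseX A B (const K) (X := res (A + B * K)) (f := delta) rfl fun k => by
    rw [res_succ, const_conv, Matrix.add_mul, Matrix.mul_assoc]
  rw [h, conv_delta]

lemma responseU_const (K : Matrix (Fin p) (Fin n) ℝ) :
    responseU A B (const K) = fun k => K * res (A + B * K) k := by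
  rw [responseU_eq_conv, const_conv, responseX_const]

/-- `K Φx = Φu` for `K = Φu Φx⁻¹`. -/
lemma controller_conv {Φx : TransferMatrix (Fin n) (Fin n)} {Φu : TransferMatrix (Fin p) (Fin n)}
    (hx0 : Φx 0 = 0) (hx1 : Φx 1 = 1) (hu0 : Φu 0 = 0) :
    conv (controller Φx Φu) Φx = Φu := by
  set I := PowerSeries.invOfUnit (PowerSeries.mk fun l => Φx (l + 1)) 1 with hI
  have h1 : I * (PowerSeries.mk fun l => Φx (l + 1)) = 1 :=
    PowerSeries.invOfUnit_mul _ _ (by simp [← PowerSeries.coeff_zero_eq_constantCoeff_apply, hx1])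
  have h2 : conv (fun k => PowerSeries.coeff k I) (fun l => Φx (l + 1)) = delta := by
    funext k
    have := congrArg (PowerSeries.coeff k) h1
    rw [PowerSeries.coeff_mul] at this
    simpa [conv_apply, PowerSeries.coeff_one, delta] using this
  have h3 : controller Φx Φu = conv (fun k => Φu (k + 1)) (fun k => PowerSeries.coeff k I) := rfl
  funext k
  cases k with
  | zero => rw [conv_zero_right_apply _ hx0, hu0]
  | succ k => rw [conv_succ_right _ hx0, h3, conv_assoc, h2, conv_delta]

/-- If `[zI - A, -B] [Φx; Φu] = I + D`, then the closed-loop responses `Φhat` of `Φu Φx⁻¹` satisfy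
`Φhat (I + D) = Φ`. -/
lemma responses_of_affine {Φx : TransferMatrix (Fin n) (Fin n)}
    {Φu : TransferMatrix (Fin p) (Fin n)} {D : TransferMatrix (Fin n) (Fin n)}
    (hx0 : Φx 0 = 0) (hx1 : Φx 1 = 1) (hu0 : Φu 0 = 0)
    (h : ∀ k, Φx (k + 1) = A * Φx k + B * Φu k + (delta k + D k)) :
    Φx = conv (responseX A B (controller Φx Φu)) (fun k => delta k + D k) ∧
    Φu = conv (responseU A B (controller Φx Φu)) (fun k => delta k + D k) := by
  have hK := controller_conv hx0 hx1 hu0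
  have h1 : Φx = conv (responseX A B (controller Φx Φu)) (fun k => delta k + D k) :=
    eq_conv_responseX A B _ hx0 fun k => by rw [hK]; exact h k
  refine ⟨h1, ?_⟩
  rw [responseU_eq_conv, conv_assoc, ← h1, hK]

end Response

/-! ### The cost of a linear time-invariant controller -/

section Cost

variable {n p : ℕ}

instance isProbabilityMeasure_noiseLaw : IsProbabilityMeasure (noiseLaw n) := by
  unfold noiseLaw; infer_instance

lemma variance_dotProduct_gaussian (v : Fin n → ℝ) :
    MemLp (fun x : Fin n → ℝ => v ⬝ᵥ x) 2 (Measure.pi fun _ => gaussianReal 0 1) ∧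
    Var[fun x : Fin n → ℝ => v ⬝ᵥ x; Measure.pi fun _ => gaussianReal 0 1] = ∑ i, v i ^ 2 ∧
    ∫ x : Fin n → ℝ, v ⬝ᵥ x ∂(Measure.pi fun _ => gaussianReal 0 1) = 0 := by
  have h1 : ∀ i, MemLp (fun x : ℝ => v i * x) 2 (gaussianReal 0 1) := fun i =>
    (memLp_id_gaussianReal 2).const_mul (v i)
  have h2 : ∀ i, MemLp (fun x : Fin n → ℝ => v i * x i) 2
      (Measure.pi fun _ => gaussianReal 0 1) := fun i =>
    (h1 i).comp_measurePreserving (measurePreserving_eval (fun _ : Fin n => gaussianReal 0 1) i)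
  have e : (fun x : Fin n → ℝ => v ⬝ᵥ x) = ∑ i, fun x : Fin n → ℝ => v i * x i := by
    funext x; simp [dotProduct]
  refine ⟨?_, ?_, ?_⟩
  · rw [e]; exact memLp_finsetSum' _ fun i _ => h2 i
  · rw [e, variance_sum_pi (X := fun i x => v i * x) h1]
    refine Finset.sum_congr rfl fun i _ => ?_
    have := variance_const_mul (v i) (id : ℝ → ℝ) (gaussianReal 0 1)
    rw [variance_id_gaussianReal] at this
    simpa using this
  · simp only [dotProduct]
    rw [integral_finsetSum _ fun i _ => (h2 i).integrable (by norm_num)]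
    refine Finset.sum_eq_zero fun i _ => ?_
    rw [integral_const_mul]
    have h3 : ∫ x : Fin n → ℝ, x i ∂(Measure.pi fun _ => gaussianReal 0 1) =
        ∫ y, y ∂(gaussianReal 0 1) := by
      have h4 := integral_map (μ := Measure.pi fun _ : Fin n => gaussianReal 0 1)
        (measurable_pi_apply i).aemeasurable (f := fun y : ℝ => y) (by fun_prop)
      have h5 : (Measure.pi fun _ : Fin n => gaussianReal 0 1).map (fun x => x i) =
          gaussianReal 0 1 := (measurePreserving_eval (fun _ => gaussianReal 0 1) i).map_eq
      rw [← h4, h5]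
    rw [h3, integral_id_gaussianReal, mul_zero]

/-- Second moment of a linear functional of the noise. -/
lemma lintegral_sq_sum_noise (s : Finset ℕ) (v : ℕ → Fin n → ℝ) :
    ∫⁻ w, ENNReal.ofReal ((∑ j ∈ s, v j ⬝ᵥ w j) ^ 2) ∂(noiseLaw n) =
      ENNReal.ofReal (∑ j ∈ s, ∑ i, v j i ^ 2) := by
  have hmp := measurePreserving_eval_infinitePi
    (fun _ : ℕ => Measure.pi fun _ : Fin n => gaussianReal 0 1)
  have hm : ∀ j, MemLp (fun w : ℕ → Fin n → ℝ => v j ⬝ᵥ w j) 2 (noiseLaw n) := fun j =>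
    (variance_dotProduct_gaussian (v j)).1.comp_measurePreserving (hmp j)
  have hmeas : ∀ j, Measurable fun x : Fin n → ℝ => v j ⬝ᵥ x := fun j => by
    unfold dotProduct; fun_prop
  have hind : iIndepFun (fun j (w : ℕ → Fin n → ℝ) => v j ⬝ᵥ w j) (noiseLaw n) :=
    iIndepFun_infinitePi (X := fun j x => v j ⬝ᵥ x) hmeas
  have hvar := IndepFun.variance_sum (s := s) (fun j _ => hm j)
    (fun i _ j _ hij => hind.indepFun hij)
  have e : (∑ j ∈ s, fun w : ℕ → Fin n → ℝ => v j ⬝ᵥ w j) =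
      fun w => ∑ j ∈ s, v j ⬝ᵥ w j := by funext w; simp
  rw [e] at hvar
  have hML : MemLp (fun w : ℕ → Fin n → ℝ => ∑ j ∈ s, v j ⬝ᵥ w j) 2 (noiseLaw n) :=
    memLp_finsetSum _ fun j _ => hm j
  have hzero : ∫ w, ∑ j ∈ s, v j ⬝ᵥ w j ∂(noiseLaw n) = 0 := by
    rw [integral_finsetSum _ fun j _ => (hm j).integrable (by norm_num)]
    refine Finset.sum_eq_zero fun j _ => ?_
    rw [← (variance_dotProduct_gaussian (v j)).2.2, ← (hmp j).map_eq,
      integral_map (measurable_pi_apply j).aemeasurable (hmeas j).aestronglyMeasurable]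
    rfl
  rw [variance_of_integral_eq_zero hML.aestronglyMeasurable.aemeasurable hzero] at hvar
  rw [← ofReal_integral_eq_lintegral_ofReal hML.integrable_sq
    (Eventually.of_forall fun _ => sq_nonneg _), hvar]
  congr 1
  refine Finset.sum_congr rfl fun j _ => ?_
  rw [← (variance_dotProduct_gaussian (v j)).2.1]
  exact (hmp j).variance_fun_comp (hmeas j).aemeasurable

variable (A : Matrix (Fin n) (Fin n) ℝ) (B : Matrix (Fin n) (Fin p) ℝ)

lemma history_apply (π : Policy n p) (w : ℕ → Fin n → ℝ) (s : ℕ → ℝ) (k : ℕ) (j : Fin (k + 1)) :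
    history A B π w s k j = state A B π w s j := by
  induction k with
  | zero => obtain rfl : j = 0 := Fin.fin_one_eq_zero j; rfl
  | succ k ih =>
    induction j using Fin.lastCases with
    | last => rfl
    | cast j =>
      rw [history, Fin.snoc_castSucc, ih]
      rfl

lemma state_zero (π : Policy n p) (w : ℕ → Fin n → ℝ) (s : ℕ → ℝ) : state A B π w s 0 = 0 := rfl

lemma state_succ (π : Policy n p) (w : ℕ → Fin n → ℝ) (s : ℕ → ℝ) (k : ℕ) :
    state A B π w s (k + 1) =
      A *ᵥ state A B π w s k + B *ᵥ input A B π w s k + w k := by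
  rw [state, history, Fin.snoc_last]
  rfl

variable (K : TransferMatrix (Fin p) (Fin n))

lemma input_lti (w : ℕ → Fin n → ℝ) (s : ℕ → ℝ) (k : ℕ) :
    input A B (ltiPolicy K) w s k =
      ∑ x ∈ antidiagonal k, K x.1 *ᵥ state A B (ltiPolicy K) w s x.2 := by
  rw [Finset.Nat.sum_antidiagonal_eq_sum_range_succ
    (fun i j => K i *ᵥ state A B (ltiPolicy K) w s j), ← Fin.sum_univ_eq_sum_range
    (fun i => K i *ᵥ state A B (ltiPolicy K) w s (k - i))]
  change ∑ j : Fin (k + 1), K j *ᵥ history A B (ltiPolicy K) w s k j.rev = _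
  refine Finset.sum_congr rfl fun j _ => ?_
  rw [history_apply, Fin.val_rev]
  congr 2
  omega

lemma replicateCol_sum {m : Type*} {ι : Type*} (s : Finset ι) (f : ι → m → ℝ) :
    Matrix.replicateCol Unit (∑ i ∈ s, f i) = ∑ i ∈ s, Matrix.replicateCol Unit (f i) := by
  ext i j; simp [Matrix.sum_apply]

/-- Signals are written as one-column matrices, so that the convolution identities for transfer
matrices apply to each trajectory. -/
lemma closed_loop (w : ℕ → Fin n → ℝ) (s : ℕ → ℝ) :
    (fun k => Matrix.replicateCol Unit (state A B (ltiPolicy K) w s k)) =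
      conv (responseX A B K) (fun k => Matrix.replicateCol Unit (w k)) ∧
    (fun k => Matrix.replicateCol Unit (input A B (ltiPolicy K) w s k)) =
      conv (responseU A B K) (fun k => Matrix.replicateCol Unit (w k)) := by
  have hu : (fun k => Matrix.replicateCol Unit (input A B (ltiPolicy K) w s k)) =
      conv K (fun k => Matrix.replicateCol Unit (state A B (ltiPolicy K) w s k)) := by
    funext k
    rw [input_lti, conv_apply, replicateCol_sum]
    exact Finset.sum_congr rfl fun x _ => Matrix.replicateCol_mulVec _ _
  have hx : (fun k => Matrix.replicateCol Unit (state A B (ltiPolicy K) w s k)) =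
      conv (responseX A B K) (fun k => Matrix.replicateCol Unit (w k)) := by
    refine eq_conv_responseX A B K ?_ fun k => ?_
    · rw [state_zero]; rfl
    · rw [← hu, state_succ, Matrix.replicateCol_add, Matrix.replicateCol_add,
        Matrix.replicateCol_mulVec, Matrix.replicateCol_mulVec]
  refine ⟨hx, ?_⟩
  rw [hu, responseU_eq_conv, conv_assoc, ← hx]

lemma conv_replicateCol_apply {m : Type*} (M : TransferMatrix m (Fin n)) (w : ℕ → Fin n → ℝ) (k : ℕ)
    (i : m) (u : Unit) : conv M (fun k => Matrix.replicateCol Unit (w k)) k i u =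
      ∑ j ∈ range (k + 1), M (k - j) i ⬝ᵥ w j := by
  rw [conv_apply, Matrix.sum_apply, ← Finset.Nat.sum_antidiagonal_swap]
  simp only [Prod.fst_swap, Prod.snd_swap]
  exact Finset.Nat.sum_antidiagonal_eq_sum_range_succ
    (fun a b => (M b * Matrix.replicateCol Unit (w a)) i u) k

lemma sum_range_froSq_reflect {a b : Type*} [Fintype a] [Fintype b] (M : TransferMatrix a b)
    (k : ℕ) : ∑ j ∈ range (k + 1), froSq (M (k - j)) = ∑ j ∈ range (k + 1), froSq (M j) := by
  rw [← Finset.sum_range_reflect (fun j => froSq (M j))]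
  exact Finset.sum_congr rfl fun j _ => by congr 2

/-- The noise is white with identity covariance, so the expected square adds up over noise times and
coordinates; reversing the order of times leaves a partial sum of the H₂ series. -/
lemma lintegral_sq_conv {m : Type*} [Fintype m] (M : TransferMatrix m (Fin n)) (k : ℕ) :
    ∫⁻ w, ENNReal.ofReal (∑ i, (∑ j ∈ range (k + 1), M (k - j) i ⬝ᵥ w j) ^ 2) ∂(noiseLaw n) =
      ENNReal.ofReal (∑ j ∈ range (k + 1), froSq (M j)) := by
  simp_rw [ENNReal.ofReal_sum_of_nonneg (s := Finset.univ) fun i _ => sq_nonneg _]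
  rw [lintegral_finsetSum]
  · simp_rw [lintegral_sq_sum_noise (range (k + 1)) (fun j => M (k - j) _)]
    rw [← ENNReal.ofReal_sum_of_nonneg fun i _ => by positivity, Finset.sum_comm,
      ← sum_range_froSq_reflect]
    simp only [froSq_real]
  · intro i _
    refine ENNReal.measurable_ofReal.comp (Measurable.pow_const ?_ 2)
    refine Finset.measurable_sum _ fun j _ => ?_
    unfold dotProduct
    fun_prop

lemma dotProduct_mulVec_eq_sqrt {m : Type*} [Fintype m] [DecidableEq m] {Q : Matrix m m ℝ}
    (hQ : Q.PosSemidef) (x : m → ℝ) : x ⬝ᵥ (Q *ᵥ x) = ∑ i, ((CFC.sqrt Q *ᵥ x) i) ^ 2 := by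
  have h1 : CFC.sqrt Q * CFC.sqrt Q = Q :=
    CFC.sqrt_mul_sqrt_self Q (Matrix.nonneg_iff_posSemidef.2 hQ)
  have h2 : (CFC.sqrt Q)ᵀ = CFC.sqrt Q := by
    have := (Matrix.nonneg_iff_posSemidef.1 (CFC.sqrt_nonneg Q)).isHermitian
    rwa [Matrix.IsHermitian, Matrix.conjTranspose_eq_transpose_of_trivial] at this
  conv_lhs => rw [← h1, ← Matrix.mulVec_mulVec, Matrix.dotProduct_mulVec, ← Matrix.mulVec_transpose,
    h2]
  simp [dotProduct, sq]

/-- The weighted closed-loop response. -/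
noncomputable def weighted (Q : Matrix (Fin n) (Fin n) ℝ) (R : Matrix (Fin p) (Fin p) ℝ)
    (X : TransferMatrix (Fin n) (Fin n)) (U : TransferMatrix (Fin p) (Fin n)) :
    TransferMatrix (Fin n ⊕ Fin p) (Fin n) :=
  stack (fun k => CFC.sqrt Q * X k) (fun k => CFC.sqrt R * U k)

variable {A B K} {Q : Matrix (Fin n) (Fin n) ℝ} {R : Matrix (Fin p) (Fin p) ℝ}

lemma stage_cost (hQ : Q.PosSemidef) (hR : R.PosSemidef) (w : ℕ → Fin n → ℝ) (s : ℕ → ℝ) (k : ℕ) :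
    state A B (ltiPolicy K) w s k ⬝ᵥ (Q *ᵥ state A B (ltiPolicy K) w s k) +
      input A B (ltiPolicy K) w s k ⬝ᵥ (R *ᵥ input A B (ltiPolicy K) w s k) =
    ∑ i, (∑ j ∈ range (k + 1),
      weighted Q R (responseX A B K) (responseU A B K) (k - j) i ⬝ᵥ w j) ^ 2 := by
  obtain ⟨hx, hu⟩ := closed_loop A B K w s
  have hx' : ∀ i, (CFC.sqrt Q *ᵥ state A B (ltiPolicy K) w s k) i = ∑ j ∈ range (k + 1),
      (CFC.sqrt Q * responseX A B K (k - j)) i ⬝ᵥ w j := fun i => by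
    rw [← conv_replicateCol_apply (fun k => CFC.sqrt Q * responseX A B K k) w k i (), mul_conv,
      ← hx]
    rfl
  have hu' : ∀ i, (CFC.sqrt R *ᵥ input A B (ltiPolicy K) w s k) i = ∑ j ∈ range (k + 1),
      (CFC.sqrt R * responseU A B K (k - j)) i ⬝ᵥ w j := fun i => by
    rw [← conv_replicateCol_apply (fun k => CFC.sqrt R * responseU A B K k) w k i (), mul_conv,
      ← hu]
    rfl
  rw [dotProduct_mulVec_eq_sqrt hQ, dotProduct_mulVec_eq_sqrt hR, Fintype.sum_sum_type]
  simp only [hx', hu']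
  rfl

lemma averageCost_lti (hQ : Q.PosSemidef) (hR : R.PosSemidef) (T : ℕ) :
    averageCost A B Q R (ltiPolicy K) T = ENNReal.ofReal (∑ k ∈ Finset.Icc 1 T,
      ∑ j ∈ range (k + 1), froSq (weighted Q R (responseX A B K) (responseU A B K) j)) / T := by
  unfold averageCost
  congr 1
  simp_rw [stage_cost hQ hR]
  have hm : ∀ k, Measurable fun w : ℕ → Fin n → ℝ => ENNReal.ofReal (∑ i, (∑ j ∈ range (k + 1),
      weighted Q R (responseX A B K) (responseU A B K) (k - j) i ⬝ᵥ w j) ^ 2) := fun k => by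
    unfold dotProduct
    fun_prop
  simp_rw [ENNReal.ofReal_sum_of_nonneg (s := Finset.Icc 1 T) fun k _ =>
    Finset.sum_nonneg fun i _ => sq_nonneg _]
  have := (ltiPolicy K).isProbabilityMeasure_seedLaw
  rw [lintegral_prod _ (by
    refine Measurable.aemeasurable (Finset.measurable_sum _ fun k _ => (hm k).comp measurable_fst))]
  simp only [lintegral_const, measure_univ, mul_one]
  rw [lintegral_finsetSum _ fun k _ => hm k]
  simp_rw [lintegral_sq_conv]
  rw [ENNReal.ofReal_sum_of_nonneg fun k _ => Finset.sum_nonneg fun _ _ => froSq_nonneg _]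

/-- The LQR cost of an LTI controller is the squared `H₂` norm of the weighted closed loop. -/
lemma hasLQRCost_lti (hQ : Q.PosSemidef) (hR : R.PosSemidef)
    (hS : IsL2 (weighted Q R (responseX A B K) (responseU A B K))) :
    HasLQRCost A B Q R (ltiPolicy K)
      (ENNReal.ofReal (h2Norm (weighted Q R (responseX A B K) (responseU A B K)) ^ 2)) := by
  unfold HasLQRCost
  set g := fun j => froSq (weighted Q R (responseX A B K) (responseU A B K) j)
  -- Expected stage costs are partial sums of the H₂ series, and Cesàro means of a convergent
  -- sequence keep its limit. The shift by two arises because the average runs over times 1, ..., T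
  -- and time k involves coefficients 0, ..., k.
  have h1 : Tendsto (fun T : ℕ => (T : ℝ)⁻¹ * ∑ k ∈ range T, ∑ j ∈ range (k + 1 + 1), g j) atTop
      (𝓝 (∑' j, g j)) := by
    refine Tendsto.cesaro ?_
    exact hS.hasSum.tendsto_sum_nat.comp (tendsto_add_atTop_nat 2)
  rw [h2Norm_sq]
  refine (ENNReal.tendsto_ofReal h1).congr' ?_
  filter_upwards [eventually_gt_atTop 0] with T hT
  have hT' : (0 : ℝ) < T := by exact_mod_cast hT
  rw [averageCost_lti hQ hR, ← ENNReal.ofReal_natCast T, ← ENNReal.ofReal_div_of_pos hT',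
    inv_mul_eq_div]
  congr 2
  rw [Finset.range_eq_Ico, Finset.sum_Ico_add' (fun k => ∑ j ∈ range (k + 1), g j) 0 T 1]
  rfl

end Cost

/-! ### Perturbation of resolvents -/

section Perturbation

/-! ### Sums, products and exponential weights of transfer matrices. -/

section EvalAlgebra

variable {a b c : Type*} [Fintype a] [Fintype b] [Fintype c] [DecidableEq b] [DecidableEq c]

omit [DecidableEq b] [Fintype b] in
lemma eval_add {a b : Type*} [Fintype a] [Fintype b] [DecidableEq b] {M N : TransferMatrix a b}
    (hM : Summable fun k => ‖M k‖) (hN : Summable fun k => ‖N k‖) (z : Circle) :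
    TransferMatrix.eval (fun k => M k + N k) z =
      TransferMatrix.eval M z + TransferMatrix.eval N z := by
  unfold TransferMatrix.eval
  rw [← (summable_eval hM z).of_norm.tsum_add (summable_eval hN z).of_norm]
  congr 1
  funext k
  rw [← smul_add]
  congr 1
  ext
  simp

/-- The transfer matrix `z⁻ᶠ V`. -/
def single {m n : Type*} (F : ℕ) (V : Matrix m n ℝ) : TransferMatrix m n :=
  fun k => if k = F then V else 0

lemma single_of_le {m n : Type*} (F : ℕ) (V : Matrix m n ℝ) (k : ℕ) (hk : F + 1 ≤ k) :
    single F V k = 0 := if_neg (by omega)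

omit [Fintype a] [Fintype b] [DecidableEq b] in
lemma eval_single (F : ℕ) (V : Matrix a b ℝ) (z : ℂ) : TransferMatrix.eval (single F V) z =
    (z⁻¹ ^ F) • V.map (fun a : ℝ => (a : ℂ)) := by
  unfold TransferMatrix.eval
  rw [tsum_eq_single F]
  · simp [single]
  · intro k hk
    ext
    simp [single, hk]

lemma norm_eval_single_le (F : ℕ) (V : Matrix a b ℝ) (z : Circle) :
    ‖TransferMatrix.eval (single F V) z‖ ≤ ‖V‖ := by
  rw [eval_single, norm_smul, norm_inv_circle_pow, one_mul]
  exact norm_map_ofReal_le V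

lemma summable_mul_left (W : Matrix a b ℝ) {M : TransferMatrix b c}
    (hM : Summable fun k => ‖M k‖) : Summable fun k => ‖W * M k‖ :=
  Summable.of_nonneg_of_le (fun _ => norm_nonneg _) (fun _ => Matrix.l2_opNorm_mul _ _)
    (hM.mul_left ‖W‖)

lemma eval_mul_left (W : Matrix a b ℝ) {M : TransferMatrix b c} (hM : Summable fun k => ‖M k‖)
    (z : Circle) : TransferMatrix.eval (fun k => W * M k) z =
      W.map (fun a : ℝ => (a : ℂ)) * TransferMatrix.eval M z := by
  have h1 := eval_conv (M := single 0 W) (summable_norm_of_fir (single_of_le 0 W)) hM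
    (by rw [show single 0 W = const W from rfl, const_conv]; exact summable_mul_left W hM) z
  rw [eval_single, show single 0 W = const W from rfl, const_conv] at h1
  simpa using h1

lemma norm_eval_mul_left_le (W : Matrix a b ℝ) {M : TransferMatrix b c}
    (hM : Summable fun k => ‖M k‖) (z : Circle) :
    ‖TransferMatrix.eval (fun k => W * M k) z‖ ≤ ‖W‖ * ‖TransferMatrix.eval M z‖ := by
  rw [eval_mul_left W hM]
  exact (Matrix.l2_opNorm_mul _ _).trans
    (mul_le_mul_of_nonneg_right (norm_map_ofReal_le W) (norm_nonneg _))

-- The weight wᵏ is the substitution of z/w for z, hence multiplicative. It turns a question about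
-- decay rates into one about norms.
omit [Fintype a] [Fintype c] [DecidableEq b] [DecidableEq c] in
lemma conv_scale (w : ℝ) (M : TransferMatrix a b) (N : TransferMatrix b c) :
    conv (fun k => w ^ k • M k) (fun k => w ^ k • N k) = fun k => w ^ k • conv M N k := by
  funext k
  simp only [conv_apply, Finset.smul_sum]
  refine Finset.sum_congr rfl fun x hx => ?_
  rw [Matrix.smul_mul, Matrix.mul_smul, smul_smul, ← pow_add,
    Finset.HasAntidiagonal.mem_antidiagonal.1 hx]

end EvalAlgebra

variable {n : ℕ}

/-- The closed-loop statement for a system without inputs. -/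
lemma eq_conv_res {c : Type*} {A : Matrix (Fin n) (Fin n) ℝ} {X f : ℕ → Matrix (Fin n) c ℝ}
    (h0 : X 0 = 0) (hX : ∀ k, X (k + 1) = A * X k + f k) : X = conv (res A) f := by
  have h := eq_conv_responseX A (0 : Matrix (Fin n) (Fin 0) ℝ) (const 0) h0
    (f := f) fun k => by rw [hX, Matrix.zero_mul, add_zero]
  rwa [responseX_const, Matrix.zero_mul, add_zero] at h

/-- The resolvent identity: the response of `L` obeys the recursion of `L + Δ` driven by the
disturbance I - Δ (zI - L)⁻¹. -/
lemma res_add (L Δ : Matrix (Fin n) (Fin n) ℝ) :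
    res (L + Δ) = res L + conv (res (L + Δ)) (fun k => Δ * res L k) := by
  have h := eq_conv_res (A := L + Δ) (X := res L)
    (f := delta + fun k => (-Δ) * res L k) rfl fun k => by
      rw [res_succ, Pi.add_apply, Matrix.add_mul, Matrix.neg_mul]; abel
  have h2 : conv (res (L + Δ)) (fun k => (-Δ) * res L k) =
      -conv (res (L + Δ)) (fun k => Δ * res L k) := by
    funext k; simp [conv_apply]
  rw [conv_add_right, conv_delta, h2, ← sub_eq_add_neg] at h
  exact (eq_sub_iff_add_eq.1 h).symm

lemma mul_res_add {m : Type*} (W : Matrix m (Fin n) ℝ) (L Δ : Matrix (Fin n) (Fin n) ℝ) :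
    (fun k => W * res (L + Δ) k) = (fun k => W * res L k) +
      conv (fun k => W * res (L + Δ) k) (fun k => Δ * res L k) := by
  rw [mul_conv]
  funext k
  conv_lhs => rw [res_add]
  rw [Pi.add_apply, Pi.add_apply, Matrix.mul_add]

lemma summable_res {L : Matrix (Fin n) (Fin n) ℝ} {C s : ℝ} (hs0 : 0 ≤ s) (hs1 : s < 1)
    (hL : ∀ k, ‖res L k‖ ≤ C * s ^ k) : Summable fun k => ‖res L k‖ :=
  Summable.of_nonneg_of_le (fun _ => norm_nonneg _) hL
    ((summable_geometric_of_lt_one hs0 hs1).mul_left C)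

variable {L Δ : Matrix (Fin n) (Fin n) ℝ} {C s η : ℝ}

lemma isL2_mul_res {m : Type*} [Fintype m] (W : Matrix m (Fin n) ℝ) (hs0 : 0 ≤ s) (hs1 : s < 1)
    (hL : ∀ k, ‖res L k‖ ≤ C * s ^ k) : IsL2 fun k => W * res L k := by
  have hs2 : s ^ 2 < 1 := by nlinarith
  refine Summable.of_nonneg_of_le (fun _ => froSq_nonneg _) (fun k => ?_)
    ((summable_geometric_of_lt_one (sq_nonneg s) hs2).mul_left (froSq W * C ^ 2))
  refine (froSq_mul_le _ _).trans ?_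
  rw [mul_assoc]
  refine mul_le_mul_of_nonneg_left ?_ (froSq_nonneg _)
  refine (pow_le_pow_left₀ (norm_nonneg _) (hL k) 2).trans (le_of_eq ?_)
  ring

/-- `H₂` norm of the perturbed closed loop. -/
lemma h2Norm_mul_res_add_le {m : Type*} [Fintype m] (W : Matrix m (Fin n) ℝ) (hs0 : 0 ≤ s)
    (hs1 : s < 1) (hL : ∀ k, ‖res L k‖ ≤ C * s ^ k) (hΔ : ‖Δ‖ ≤ η)
    (hζ : η * hinfNorm (res L) < 1) :
    IsL2 (fun k => W * res (L + Δ) k) ∧ h2Norm (fun k => W * res (L + Δ) k) ≤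
      1 / (1 - η * hinfNorm (res L)) * h2Norm (fun k => W * res L k) := by
  have hsum := summable_res hs0 hs1 hL
  refine h2Norm_le_of_eq_add_conv (mul_res_add W L Δ) (summable_mul_left Δ hsum) (fun z => ?_) hζ
    (isL2_mul_res W hs0 hs1 hL)
  exact (norm_eval_mul_left_le Δ hsum z).trans (mul_le_mul hΔ (norm_eval_le_hinfNorm hsum z)
    (norm_nonneg _) ((norm_nonneg _).trans hΔ))

/-- Passing from |z| = 1 to |z| = r, with r = (s + 3)/4, costs at most the sum of C sᵏ (r⁻ᵏ - 1).
Since r - s = 3(1 - s)/4, this sum equals C s / (3(1 - s)). -/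
lemma norm_eval_scaled_res_le (hs0 : 0 < s) (hs1 : s < 1) (hC : 0 ≤ C)
    (hL : ∀ k, ‖res L k‖ ≤ C * s ^ k) (z : Circle) :
    (Summable fun k => ‖((1 / 4 * s + 3 / 4)⁻¹ ^ k : ℝ) • res L k‖) ∧
    ‖TransferMatrix.eval (fun k => ((1 / 4 * s + 3 / 4)⁻¹ ^ k : ℝ) • res L k) z‖ ≤
      hinfNorm (res L) + C / (3 * (1 - s)) := by
  set r := 1 / 4 * s + 3 / 4 with hr
  have hr0 : 0 < r := by positivity
  have hr1 : r < 1 := by rw [hr]; linarith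
  have hsr : s < r := by rw [hr]; linarith
  have hsum := summable_res hs0.le hs1 hL
  have ha0 : 0 ≤ r⁻¹ * s := by positivity
  have ha1 : r⁻¹ * s < 1 := by rw [inv_mul_lt_iff₀ hr0]; linarith
  have hw : ∀ k, 1 ≤ r⁻¹ ^ k := fun k => one_le_pow₀ ((one_le_inv₀ hr0).2 hr1.le)
  have hb : ∀ k, ‖((r⁻¹ ^ k - 1 : ℝ)) • res L k‖ ≤ C * ((r⁻¹ * s) ^ k - s ^ k) := fun k => by
    rw [norm_smul, Real.norm_of_nonneg (by linarith [hw k])]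
    refine (mul_le_mul_of_nonneg_left (hL k) (by linarith [hw k])).trans (le_of_eq ?_)
    rw [mul_pow]; ring
  have hg := ((hasSum_geometric_of_lt_one ha0 ha1).sub
    (hasSum_geometric_of_lt_one hs0.le hs1)).mul_left C
  have hd : Summable fun k => ‖((r⁻¹ ^ k - 1 : ℝ)) • res L k‖ :=
    Summable.of_nonneg_of_le (fun _ => norm_nonneg _) hb hg.summable
  have e : (fun k => (r⁻¹ ^ k : ℝ) • res L k) =
      fun k => res L k + (r⁻¹ ^ k - 1 : ℝ) • res L k := by
    funext k; rw [sub_smul, one_smul]; abel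
  have hsum' : Summable fun k => ‖(r⁻¹ ^ k : ℝ) • res L k‖ := by
    simp only [funext_iff] at e
    simp only [e]
    exact Summable.of_nonneg_of_le (fun _ => norm_nonneg _) (fun _ => norm_add_le _ _)
      (hsum.add hd)
  refine ⟨hsum', ?_⟩
  rw [e, eval_add hsum hd]
  refine (norm_add_le _ _).trans (add_le_add (norm_eval_le_hinfNorm hsum z) ?_)
  refine (norm_eval_le hd z).trans ((hd.tsum_le_tsum hb hg.summable).trans ?_)
  rw [hg.tsum_eq, div_eq_mul_inv]
  refine mul_le_mul_of_nonneg_left ?_ hC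
  have h1 : 1 - r⁻¹ * s ≠ 0 := by linarith
  have h2 : 1 - s ≠ 0 := by linarith
  have e1 : (1 - r⁻¹ * s)⁻¹ = r / (3 / 4 * (1 - s)) := by
    rw [inv_eq_one_div, div_eq_div_iff h1 (by positivity)]
    field_simp
    rw [hr]; ring
  rw [e1, hr]
  have h3 : 0 < 1 - s := by linarith
  rw [← sub_nonneg]
  have : (3 * (1 - s))⁻¹ - ((1 / 4 * s + 3 / 4) / (3 / 4 * (1 - s)) - (1 - s)⁻¹) = 1 / 3 := by
    field_simp; ring
  rw [this]; norm_num

/-- Geometric decay of the perturbed closed loop. -/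
lemma norm_res_add_le (hs0 : 0 < s) (hs1 : s < 1) (hC : 0 ≤ C)
    (hL : ∀ k, ‖res L k‖ ≤ C * s ^ k) (hΔ : ‖Δ‖ ≤ η) (hζ : η * hinfNorm (res L) ≤ 1 / 5)
    (hη : η * C ≤ 1 - s) (k : ℕ) :
    ‖res (L + Δ) k‖ ≤ 5 / 2 * (C / (1 - s)) * (1 / 4 * s + 3 / 4) ^ k := by
  set r := 1 / 4 * s + 3 / 4 with hr
  have hr0 : 0 < r := by positivity
  have hr1 : r < 1 := by rw [hr]; linarith
  have hd : 0 < 1 - s := by linarith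
  have hη0 : 0 ≤ η := (norm_nonneg _).trans hΔ
  set a := r⁻¹ * s with ha
  have ha0 : 0 ≤ a := by positivity
  have ha1 : a < 1 := by rw [ha, inv_mul_lt_iff₀ hr0]; linarith
  have hL' : ∀ k, ‖(r⁻¹ ^ k : ℝ) • res L k‖ ≤ C * a ^ k := fun k => by
    rw [norm_smul, Real.norm_of_nonneg (by positivity), ha, mul_pow]
    refine (mul_le_mul_of_nonneg_left (hL k) (by positivity)).trans (le_of_eq (by ring))
  have hN : (fun k => (r⁻¹ ^ k : ℝ) • (Δ * res L k)) =
      fun k => Δ * ((r⁻¹ ^ k : ℝ) • res L k) := by funext k; rw [Matrix.mul_smul]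
  -- The ℓ² argument controls Frobenius norms. Applying it to one row vector `v` at a time yields a
  -- spectral norm bound with no dimension factor.
  have key : ∀ v : Fin n → ℝ, froSq (Matrix.replicateRow Unit v * res (L + Δ) k) ≤
      (5 / 2 * (C / (1 - s)) * r ^ k) ^ 2 * ∑ j, ‖v j‖ ^ 2 := by
    intro v
    set W := Matrix.replicateRow Unit v with hW
    have hWf : froSq W = ∑ j, ‖v j‖ ^ 2 := by simp [froSq, hW]
    have hY : (fun k => (r⁻¹ ^ k : ℝ) • (W * res (L + Δ) k)) =
        (fun k => (r⁻¹ ^ k : ℝ) • (W * res L k)) +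
        conv (fun k => (r⁻¹ ^ k : ℝ) • (W * res (L + Δ) k))
          (fun k => (r⁻¹ ^ k : ℝ) • (Δ * res L k)) := by
      rw [conv_scale]
      funext k
      rw [Pi.add_apply, ← smul_add]
      congr 1
      exact congrFun (mul_res_add W L Δ) k
    -- 8/15 = 1/5 + 1/3: the first part is the bound on ζ, the second comes from η C ≤ 1 - s and the
    -- cost of moving to radius r.
    have hν : ∀ z : Circle,
        ‖TransferMatrix.eval (fun k => (r⁻¹ ^ k : ℝ) • (Δ * res L k)) z‖ ≤ 8 / 15 := fun z => by
      obtain ⟨h1, h2⟩ := norm_eval_scaled_res_le hs0 hs1 hC hL z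
      rw [hN]
      refine (norm_eval_mul_left_le Δ h1 z).trans
        ((mul_le_mul hΔ h2 (norm_nonneg _) hη0).trans ?_)
      have h3 : η * (C / (3 * (1 - s))) ≤ 1 / 3 := by
        rw [← mul_div_assoc, div_le_div_iff₀ (by positivity) (by norm_num)]
        linarith
      rw [mul_add]; linarith
    have hsumN : Summable fun k => ‖(r⁻¹ ^ k : ℝ) • (Δ * res L k)‖ := by
      simp only [Matrix.mul_smul] at hN
      have := summable_mul_left Δ (norm_eval_scaled_res_le hs0 hs1 hC hL 1).1
      simpa only [Matrix.mul_smul] using this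
    have h1 := l2Norm_le_of_eq_add_conv hY hsumN hν (by norm_num) (k + 1)
    have h2 : l2Norm (k + 1) (fun k => (r⁻¹ ^ k : ℝ) • (W * res L k)) ^ 2 ≤
        froSq W * (C ^ 2 * (4 / (3 * (1 - s) ^ 2))) := by
      rw [l2Norm, Real.sq_sqrt (Finset.sum_nonneg fun _ _ => froSq_nonneg _)]
      have h3 : ∀ k, froSq ((r⁻¹ ^ k : ℝ) • (W * res L k)) ≤ froSq W * (C ^ 2 * (a ^ 2) ^ k) := by
        intro k
        rw [← Matrix.mul_smul]
        refine (froSq_mul_le _ _).trans (mul_le_mul_of_nonneg_left ?_ (froSq_nonneg _))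
        refine (pow_le_pow_left₀ (norm_nonneg _) (hL' k) 2).trans (le_of_eq (by ring))
      refine (Finset.sum_le_sum fun k _ => h3 k).trans ?_
      rw [← Finset.mul_sum, ← Finset.mul_sum]
      refine mul_le_mul_of_nonneg_left (mul_le_mul_of_nonneg_left ?_ (sq_nonneg _))
        (froSq_nonneg _)
      have ha2 : a ^ 2 < 1 := by nlinarith
      refine ((summable_geometric_of_lt_one (sq_nonneg a) ha2).sum_le_tsum _
        fun _ _ => by positivity).trans ?_
      rw [tsum_geometric_of_lt_one (sq_nonneg a) ha2, inv_eq_one_div,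
        div_le_div_iff₀ (by linarith) (by positivity)]
      -- 1 - a² ≥ 1 - a ≥ 3(1 - s)/4, and a further factor 1 - s ≤ 1 is given away to obtain a
      -- perfect square.
      have h4 : 1 - a ≥ 3 / 4 * (1 - s) := by
        have : r * (1 - a) = 3 / 4 * (1 - s) := by
          rw [ha]; field_simp; rw [hr]; ring
        nlinarith
      nlinarith
    have h5 : froSq ((r⁻¹ ^ k : ℝ) • (W * res (L + Δ) k)) ≤
        l2Norm (k + 1) (fun k => (r⁻¹ ^ k : ℝ) • (W * res (L + Δ) k)) ^ 2 := by
      rw [l2Norm, Real.sq_sqrt (Finset.sum_nonneg fun _ _ => froSq_nonneg _)]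
      exact Finset.single_le_sum (f := fun k => froSq ((r⁻¹ ^ k : ℝ) • (W * res (L + Δ) k)))
        (fun _ _ => froSq_nonneg _) (Finset.self_mem_range_succ k)
    have h6 := pow_le_pow_left₀ (l2Norm_nonneg _ _) h1 2
    have h7 : froSq ((r⁻¹ ^ k : ℝ) • (W * res (L + Δ) k)) =
        (r⁻¹ ^ k) ^ 2 * froSq (W * res (L + Δ) k) := by
      simp only [froSq, Matrix.smul_apply, norm_smul, mul_pow, Finset.mul_sum,
        Real.norm_eq_abs, sq_abs]
    rw [h7] at h5
    have h8 : froSq (W * res (L + Δ) k) =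
        (r ^ k) ^ 2 * ((r⁻¹ ^ k) ^ 2 * froSq (W * res (L + Δ) k)) := by
      rw [← mul_assoc, ← mul_pow, ← mul_pow, mul_inv_cancel₀ hr0.ne', one_pow, one_pow, one_mul]
    rw [h8, ← hWf]
    have h9 : (5 / 2 * (C / (1 - s)) * r ^ k) ^ 2 * froSq W =
        (r ^ k) ^ 2 * (25 / 4 * (C ^ 2 / (1 - s) ^ 2) * froSq W) := by
      rw [← div_pow]; ring
    rw [h9]
    refine mul_le_mul_of_nonneg_left ?_ (by positivity)
    refine h5.trans (h6.trans ?_)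
    rw [mul_pow]
    have h10 : froSq W * (C ^ 2 * (4 / (3 * (1 - s) ^ 2))) =
        4 / 3 * (C ^ 2 / (1 - s) ^ 2 * froSq W) := by field_simp
    rw [h10] at h2
    have h11 : 0 ≤ C ^ 2 / (1 - s) ^ 2 * froSq W := mul_nonneg (by positivity) (froSq_nonneg _)
    -- The constant 5/2 suffices because (1 - 8/15)⁻² · 4/3 = 300/49 ≤ 25/4.
    norm_num at h2 ⊢
    linarith
  rw [← Matrix.l2_opNorm_conjTranspose]
  refine norm_le_of_sum_sq_mulVec_le (by positivity) fun v => ?_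
  refine le_trans (le_of_eq ?_) (key v)
  simp [froSq, Matrix.mulVec, Matrix.mul_apply, dotProduct, mul_comm]

/-- `H_∞` norm of the truncated perturbed closed loop. -/
lemma norm_eval_trunc_res_add_le (hs0 : 0 < s) (hs1 : s < 1)
    (hL : ∀ k, ‖res L k‖ ≤ C * s ^ k) (hΔ : ‖Δ‖ ≤ η) (hζ : η * hinfNorm (res L) ≤ 1 / 5)
    (F : ℕ) (z : Circle) :
    ‖TransferMatrix.eval (trunc (F + 1) (res (L + Δ))) z‖ ≤
      hinfNorm (res L) * (1 + ‖(L + Δ) ^ F‖) / (1 - η * hinfNorm (res L)) := by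
  set P := trunc (F + 1) (res (L + Δ)) with hP
  set V := -((L + Δ) ^ F) with hV
  have hsum := summable_res hs0.le hs1 hL
  have hPs : Summable fun k => ‖P k‖ := summable_norm_of_fir (trunc_of_le _)
  -- The truncated response obeys the recursion of `L + Δ` with one extra disturbance: at time `F`
  -- the input `V` cancels the next coefficient (L + Δ)^F.
  have hrec : P = conv (res L) (fun k => (single 0 1 k + Δ * P k) + single F V k) := by
    refine eq_conv_res (by simp [hP, trunc, res]) fun k => ?_
    rcases lt_trichotomy k F with h | h | h
    · rw [hP, trunc_of_lt _ (by omega), trunc_of_lt _ (by omega), res_succ, Matrix.add_mul]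
      simp [single, h.ne, delta]; abel
    · subst h
      rw [hP, trunc_of_le _ _ le_rfl, trunc_of_lt _ (by omega)]
      have := res_succ (L + Δ) k
      rw [Matrix.add_mul] at this
      have h2 : res (L + Δ) (k + 1) = -V := by simp [res, hV]
      rw [h2] at this
      have h3 : single k V k = V := by simp [single]
      have h4 : single 0 (1 : Matrix (Fin n) (Fin n) ℝ) k = delta k := rfl
      rw [h3, h4, ← neg_eq_iff_add_eq_zero.1 this]
      abel
    · rw [hP, trunc_of_le _ _ (by omega), trunc_of_le _ _ (by omega)]
      simp [single, h.ne', (Nat.pos_of_ne_zero (by omega : k ≠ 0)).ne']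
  have h1s : Summable fun k => ‖single 0 (1 : Matrix (Fin n) (Fin n) ℝ) k‖ :=
    summable_norm_of_fir (single_of_le _ _)
  have hVs : Summable fun k => ‖single F V k‖ := summable_norm_of_fir (single_of_le _ _)
  have hΔs := summable_mul_left Δ hPs
  have h12 : Summable fun k => ‖single 0 (1 : Matrix (Fin n) (Fin n) ℝ) k + Δ * P k‖ :=
    Summable.of_nonneg_of_le (fun _ => norm_nonneg _) (fun _ => norm_add_le _ _) (h1s.add hΔs)
  have h123 : Summable fun k => ‖(single 0 1 k + Δ * P k) + single F V k‖ :=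
    Summable.of_nonneg_of_le (fun _ => norm_nonneg _) (fun _ => norm_add_le _ _) (h12.add hVs)
  have he := eval_conv hsum h123 (by rw [← hrec]; exact hPs) z
  rw [← hrec, eval_add h12 hVs, eval_add h1s hΔs] at he
  have hh := hinfNorm_nonneg (res L)
  -- An inequality x ≤ h(1 + ηx + ‖V‖) with ηh < 1, to be solved for x.
  have h1 : ‖TransferMatrix.eval P z‖ ≤ hinfNorm (res L) *
      ((1 + η * ‖TransferMatrix.eval P z‖) + ‖(L + Δ) ^ F‖) := by
    conv_lhs => rw [he]
    refine (Matrix.l2_opNorm_mul _ _).trans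
      (mul_le_mul (norm_eval_le_hinfNorm hsum z) ?_ (norm_nonneg _) hh)
    refine (norm_add_le _ _).trans (add_le_add ((norm_add_le _ _).trans (add_le_add ?_ ?_)) ?_)
    · exact (norm_eval_single_le _ _ z).trans norm_one_le
    · exact (norm_eval_mul_left_le Δ hPs z).trans
        (mul_le_mul_of_nonneg_right hΔ (norm_nonneg _))
    · exact (norm_eval_single_le _ _ z).trans (by rw [hV, norm_neg])
  rw [le_div_iff₀ (by linarith)]
  nlinarith

end Perturbation

/-! ### The truncated static feedback is feasible -/

section Feasible

lemma isRational_of_fir {m n : Type*} {M : TransferMatrix m n} {F : ℕ}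
    (h : ∀ k, F < k → M k = 0) : IsRational M := by
  refine ⟨Polynomial.monomial F 1, by simp, fun j hj => ?_⟩
  rw [Polynomial.sum_monomial_index _ _ (by simp), h _ (by omega), smul_zero]

lemma mem_strictFIR {m n : Type*} [Fintype m] [Fintype n] [DecidableEq n] {M : TransferMatrix m n}
    {F : ℕ} {C ρ : ℝ} (hρ0 : 0 ≤ ρ) (hρ1 : ρ < 1) (hM : ∀ k, ‖M k‖ ≤ C * ρ ^ k) (h0 : M 0 = 0)
    (h : ∀ k, F < k → M k = 0) : M ∈ strictFIR F C ρ :=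
  ⟨⟨⟨isRational_of_fir h, C, ρ, hρ1, hρ0, hM⟩, fun k _ => hM k⟩, h0, h⟩

/-- Standing assumptions on the plant, the estimates and the parameters of the program. -/
structure Setting {n p : ℕ} (A : Matrix (Fin n) (Fin n) ℝ) (B : Matrix (Fin n) (Fin p) ℝ)
    (K : Matrix (Fin p) (Fin n) ℝ) (C s : ℝ) (P : Program n p) : Prop where
  C_nonneg : 0 ≤ C
  s_pos : 0 < s
  s_lt_one : s < 1
  norm_res_le : ∀ k, ‖res (A + B * K) k‖ ≤ C * s ^ k
  zeta_le : P.ε * (1 + ‖K‖) * hinfNorm (res (A + B * K)) ≤ 1 / 5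
  eps_C_le : P.ε * (1 + ‖K‖) * C ≤ 1 - s
  norm_A_sub : ‖P.Ahat - A‖ ≤ P.ε
  norm_B_sub : ‖P.Bhat - B‖ ≤ P.ε
  Cx_eq : P.Cx = 100 * C / (1 - s)
  Cu_eq : P.Cu = 100 * ‖K‖ * C / (1 - s)
  ρ_eq : P.ρ = 1 / 4 * s + 3 / 4
  tail_le : P.Cx * P.ρ ^ (P.F + 1) ≤ 1 / 2

variable {n p : ℕ} {A : Matrix (Fin n) (Fin n) ℝ} {B : Matrix (Fin n) (Fin p) ℝ}
  {K : Matrix (Fin p) (Fin n) ℝ} {C s : ℝ} {P : Program n p}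

/-- The tail bound `Cx ρ^{F+1}`. -/
def Program.tail (P : Program n p) : ℝ := P.Cx * P.ρ ^ (P.F + 1)

/-- The decision given by the truncated responses of a static feedback on the estimated system. -/
noncomputable def staticDecision (P : Program n p) (K : Matrix (Fin p) (Fin n) ℝ) :
    Decision n p where
  -- The smallest value that the robust constraint permits.
  γ := Real.sqrt 2 * P.ε / (1 - P.Cx * P.ρ ^ (P.F + 1)) *
    hinfNorm (stack (trunc (P.F + 1) (res (P.Ahat + P.Bhat * K)))
      (fun k => K * trunc (P.F + 1) (res (P.Ahat + P.Bhat * K)) k))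
  Φx := trunc (P.F + 1) (res (P.Ahat + P.Bhat * K))
  Φu := fun k => K * trunc (P.F + 1) (res (P.Ahat + P.Bhat * K)) k
  V := -(P.Ahat + P.Bhat * K) ^ P.F

namespace Setting

variable (S : Setting A B K C s P)
include S

lemma eps_nonneg : 0 ≤ P.ε := (norm_nonneg _).trans S.norm_A_sub

lemma ρ_pos : 0 < P.ρ := by rw [S.ρ_eq]; linarith [S.s_pos]

lemma ρ_lt_one : P.ρ < 1 := by rw [S.ρ_eq]; linarith [S.s_lt_one]

lemma Cx_nonneg : 0 ≤ P.Cx := by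
  rw [S.Cx_eq]
  have := S.C_nonneg
  have := S.s_lt_one
  exact div_nonneg (by linarith) (by linarith)

lemma Cu_eq_mul : P.Cu = ‖K‖ * P.Cx := by rw [S.Cu_eq, S.Cx_eq]; ring

lemma Cu_nonneg : 0 ≤ P.Cu := by
  rw [S.Cu_eq_mul]; exact mul_nonneg (norm_nonneg _) S.Cx_nonneg

lemma tail_nonneg : 0 ≤ P.tail := mul_nonneg S.Cx_nonneg (pow_nonneg S.ρ_pos.le _)

lemma tail_le_half : P.tail ≤ 1 / 2 := S.tail_le

lemma zeta_nonneg : 0 ≤ P.ε * (1 + ‖K‖) * hinfNorm (res (A + B * K)) :=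
  mul_nonneg (mul_nonneg S.eps_nonneg (by positivity)) (hinfNorm_nonneg _)

omit S in
lemma closedLoop_eq (A : Matrix (Fin n) (Fin n) ℝ) (B : Matrix (Fin n) (Fin p) ℝ)
    (K : Matrix (Fin p) (Fin n) ℝ) (P : Program n p) : P.Ahat + P.Bhat * K =
    (A + B * K) + ((P.Ahat - A) + (P.Bhat - B) * K) := by
  rw [Matrix.sub_mul]; abel

lemma norm_perturbation_le : ‖(P.Ahat - A) + (P.Bhat - B) * K‖ ≤ P.ε * (1 + ‖K‖) := by
  refine (norm_add_le _ _).trans ?_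
  rw [mul_add, mul_one]
  exact add_le_add S.norm_A_sub ((Matrix.l2_opNorm_mul _ _).trans
    (mul_le_mul_of_nonneg_right S.norm_B_sub (norm_nonneg _)))

/-- The perturbation bound has constant 5/2 against the 100 in `Cx`. The spare factor 40 makes the
residual `V` at most 1/80. -/
lemma norm_res_hat_le (k : ℕ) :
    ‖res (P.Ahat + P.Bhat * K) k‖ ≤ 1 / 40 * (P.Cx * P.ρ ^ k) := by
  have h := norm_res_add_le S.s_pos S.s_lt_one S.C_nonneg S.norm_res_le S.norm_perturbation_le
    S.zeta_le S.eps_C_le k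
  rw [closedLoop_eq A B K P]
  refine h.trans (le_of_eq ?_)
  rw [S.ρ_eq, S.Cx_eq]
  ring

lemma norm_pow_hat_le : ‖(P.Ahat + P.Bhat * K) ^ P.F‖ ≤ 1 / 40 * P.tail :=
  S.norm_res_hat_le (P.F + 1)

lemma norm_trunc_res_hat_le (k : ℕ) :
    ‖trunc (P.F + 1) (res (P.Ahat + P.Bhat * K)) k‖ ≤ P.Cx * P.ρ ^ k := by
  have h0 : 0 ≤ P.Cx * P.ρ ^ k := mul_nonneg S.Cx_nonneg (pow_nonneg S.ρ_pos.le _)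
  unfold trunc
  split_ifs
  · linarith [S.norm_res_hat_le k]
  · simpa using h0

/-- The ingredients are √2 ≤ 1.415, (1 - τ)⁻¹ ≤ 2 and (1 + 1/80)/(1 - 1/5) = 81/64, whose product is
below 18/5. With ζ ≤ 1/5 this keeps γ at most 18/25. -/
lemma γ_staticDecision_le : (staticDecision P K).γ ≤
    18 / 5 * (P.ε * (1 + ‖K‖) * hinfNorm (res (A + B * K))) := by
  set ζ := P.ε * (1 + ‖K‖) * hinfNorm (res (A + B * K)) with hζ
  set M := P.Ahat + P.Bhat * K with hM
  have hτ0 := S.tail_nonneg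
  have hτ1 := S.tail_le_half
  have hζ0 : 0 ≤ ζ := S.zeta_nonneg
  have hζ1 : ζ ≤ 1 / 5 := S.zeta_le
  have hε := S.eps_nonneg
  have hh := hinfNorm_nonneg (res (A + B * K))
  have h1 : ∀ z : Circle, ‖TransferMatrix.eval (stack (trunc (P.F + 1) (res M))
      (fun k => K * trunc (P.F + 1) (res M) k)) z‖ ≤
      (1 + ‖K‖) * (hinfNorm (res (A + B * K)) * (1 + ‖M ^ P.F‖) / (1 - ζ)) := fun z => by
    -- Both responses are the single response Φx multiplied by the constant matrix [I; K], whose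
    -- norm is at most 1 + ‖K‖.
    have e : stack (trunc (P.F + 1) (res M)) (fun k => K * trunc (P.F + 1) (res M) k) =
        fun k => Matrix.fromRows 1 K * trunc (P.F + 1) (res M) k := by
      funext k; rw [Matrix.fromRows_mul, Matrix.one_mul]; rfl
    rw [e]
    refine (norm_eval_mul_left_le _ (summable_norm_of_fir (trunc_of_le _)) z).trans ?_
    refine mul_le_mul ((norm_fromRows_le _ _).trans (add_le_add norm_one_le le_rfl)) ?_
      (norm_nonneg _) (by positivity)
    have := norm_eval_trunc_res_add_le S.s_pos S.s_lt_one S.norm_res_le S.norm_perturbation_le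
      S.zeta_le P.F z
    rwa [← closedLoop_eq A B K P] at this
  have h2 := hinfNorm_le h1
  have hs2 : Real.sqrt 2 ≤ 1.415 := by
    rw [Real.sqrt_le_left (by norm_num)]; norm_num
  have h3 : ‖M ^ P.F‖ ≤ 1 / 80 := S.norm_pow_hat_le.trans (by linarith)
  have h4 : (staticDecision P K).γ = Real.sqrt 2 * P.ε / (1 - P.tail) *
    hinfNorm (stack (trunc (P.F + 1) (res M)) (fun k => K * trunc (P.F + 1) (res M) k)) := rfl
  rw [h4, div_mul_eq_mul_div, div_le_iff₀ (by linarith)]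
  have h5 : Real.sqrt 2 * P.ε * hinfNorm (stack (trunc (P.F + 1) (res M))
      (fun k => K * trunc (P.F + 1) (res M) k)) ≤
      Real.sqrt 2 * (ζ * (1 + ‖M ^ P.F‖) / (1 - ζ)) := by
    refine (mul_le_mul_of_nonneg_left h2 (by positivity)).trans (le_of_eq ?_)
    rw [hζ]; ring
  refine h5.trans ?_
  have h6 : ζ * (1 + ‖M ^ P.F‖) / (1 - ζ) ≤ ζ * (81 / 64) := by
    rw [div_le_iff₀ (by linarith)]
    nlinarith
  have h7 : Real.sqrt 2 * (ζ * (1 + ‖M ^ P.F‖) / (1 - ζ)) ≤ 1.415 * (ζ * (81 / 64)) :=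
    mul_le_mul hs2 h6 (div_nonneg (by positivity) (by linarith)) (by norm_num)
  nlinarith

lemma feasible_staticDecision : P.Feasible (staticDecision P K) where
  γ_nonneg := by
    have := S.tail_le_half
    refine mul_nonneg (div_nonneg (mul_nonneg (Real.sqrt_nonneg _) S.eps_nonneg) ?_)
      (hinfNorm_nonneg _)
    change 0 ≤ 1 - P.tail
    linarith
  γ_lt_one := by linarith [S.γ_staticDecision_le, S.zeta_le]
  affine_zero := rfl
  affine := fun k => by
    change trunc (P.F + 1) (res (P.Ahat + P.Bhat * K)) (k + 1) -
      P.Ahat * trunc (P.F + 1) (res (P.Ahat + P.Bhat * K)) k -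
      P.Bhat * (K * trunc (P.F + 1) (res (P.Ahat + P.Bhat * K)) k) = delta k +
        (if k = P.F then -(P.Ahat + P.Bhat * K) ^ P.F else 0)
    set M := P.Ahat + P.Bhat * K with hM
    have e : ∀ X : Matrix (Fin n) (Fin n) ℝ, P.Ahat * X + P.Bhat * (K * X) = M * X := fun X => by
      rw [hM, Matrix.add_mul, Matrix.mul_assoc]
    rw [sub_sub, e]
    rcases lt_trichotomy k P.F with h | h | h
    · rw [trunc_of_lt _ (by omega), trunc_of_lt _ (by omega), res_succ, if_neg h.ne]
      abel
    -- At time `F` the cutoff removes the coefficient `M ^ F` of index `F + 1`; its absence is the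
    -- residual `V`.
    · rw [trunc_of_le _ _ (by omega), trunc_of_lt _ (by omega), if_pos h]
      have := res_succ M k
      rw [show res M (k + 1) = M ^ k from rfl, h] at this
      rw [this, h]
      abel
    · rw [trunc_of_le _ _ (by omega), trunc_of_le _ _ (by omega), if_neg h.ne', delta,
        if_neg (by omega)]
      simp
  robust := le_rfl
  norm_V := by
    change ‖-(P.Ahat + P.Bhat * K) ^ P.F‖ ≤ P.tail
    rw [norm_neg]
    linarith [S.norm_pow_hat_le, S.tail_nonneg]
  memX := mem_strictFIR S.ρ_pos.le S.ρ_lt_one S.norm_trunc_res_hat_le rfl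
    fun k hk => trunc_of_le _ k hk
  memU := by
    refine mem_strictFIR S.ρ_pos.le S.ρ_lt_one (fun k => ?_) (Matrix.mul_zero K) fun k hk => ?_
    · rw [S.Cu_eq_mul, mul_assoc]
      exact (Matrix.l2_opNorm_mul _ _).trans
        (mul_le_mul_of_nonneg_left (S.norm_trunc_res_hat_le k) (norm_nonneg _))
    · change K * trunc _ _ k = 0
      rw [trunc_of_le _ k hk, Matrix.mul_zero]

omit S in
lemma weighted_mul_left (Q : Matrix (Fin n) (Fin n) ℝ) (R : Matrix (Fin p) (Fin p) ℝ)
    (X : TransferMatrix (Fin n) (Fin n)) : weighted Q R X (fun k => K * X k) =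
      fun k => Matrix.fromRows (CFC.sqrt Q) (CFC.sqrt R * K) * X k := by
  funext k
  rw [Matrix.fromRows_mul, Matrix.mul_assoc]
  rfl

lemma isL2_weighted_res (Q : Matrix (Fin n) (Fin n) ℝ) (R : Matrix (Fin p) (Fin p) ℝ) :
    IsL2 (weighted Q R (res (A + B * K)) (fun k => K * res (A + B * K) k)) := by
  rw [weighted_mul_left]
  exact isL2_mul_res _ S.s_pos.le S.s_lt_one S.norm_res_le

lemma objective_staticDecision_le : P.objective (staticDecision P K) ≤
    (1 + 20 * (P.ε * (1 + ‖K‖) * hinfNorm (res (A + B * K)))) *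
      h2Norm (weighted P.Q P.R (res (A + B * K)) (fun k => K * res (A + B * K) k)) := by
  set ζ := P.ε * (1 + ‖K‖) * hinfNorm (res (A + B * K)) with hζ
  have hζ0 : 0 ≤ ζ := S.zeta_nonneg
  have hζ1 : ζ ≤ 1 / 5 := S.zeta_le
  set W := Matrix.fromRows (CFC.sqrt P.Q) (CFC.sqrt P.R * K) with hW
  obtain ⟨h1, h2⟩ := h2Norm_mul_res_add_le W S.s_pos.le S.s_lt_one S.norm_res_le
    S.norm_perturbation_le (lt_of_le_of_lt S.zeta_le (by norm_num))
  rw [← closedLoop_eq A B K P] at h1 h2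
  have h3 := h2Norm_trunc_le h1 (P.F + 1)
  have e : trunc (P.F + 1) (fun k => W * res (P.Ahat + P.Bhat * K) k) =
      weighted P.Q P.R (staticDecision P K).Φx (staticDecision P K).Φu := by
    rw [show (staticDecision P K).Φu = fun k => K * (staticDecision P K).Φx k from rfl,
      weighted_mul_left]
    funext k
    change trunc (P.F + 1) _ k = W * trunc (P.F + 1) (res (P.Ahat + P.Bhat * K)) k
    rcases lt_or_ge k (P.F + 1) with h | h
    · rw [trunc_of_lt _ h, trunc_of_lt _ h]
    · rw [trunc_of_le _ _ h, trunc_of_le _ _ h, Matrix.mul_zero]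
  rw [e] at h3
  have hγ := S.γ_staticDecision_le
  rw [← hζ] at hγ h2
  have h4 := h3.trans h2
  rw [weighted_mul_left, ← hW]
  set H := h2Norm fun k => W * res (A + B * K) k with hH
  have hH0 : 0 ≤ H := h2Norm_nonneg _
  change 1 / (1 - (staticDecision P K).γ) *
    h2Norm (weighted P.Q P.R (staticDecision P K).Φx (staticDecision P K).Φu) ≤ _
  set γ := (staticDecision P K).γ
  have hγ1 : 0 < 1 - γ := by linarith
  calc 1 / (1 - γ) * h2Norm (weighted P.Q P.R (staticDecision P K).Φx (staticDecision P K).Φu)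
      ≤ 1 / (1 - γ) * (1 / (1 - ζ) * H) := mul_le_mul_of_nonneg_left h4 (by positivity)
    _ ≤ 1 / (1 - 18 / 5 * ζ) * (1 / (1 - ζ) * H) := by
        refine mul_le_mul_of_nonneg_right ?_ (mul_nonneg (by
          rw [one_div, inv_nonneg]; linarith) hH0)
        exact one_div_le_one_div_of_le (by linarith) (by linarith)
    _ = (1 / ((1 - 18 / 5 * ζ) * (1 - ζ))) * H := by rw [one_div_mul_eq_div]; field_simp
    _ ≤ (1 + 20 * ζ) * H := by
        refine mul_le_mul_of_nonneg_right ?_ hH0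
        rw [div_le_iff₀ (mul_pos (by linarith) (by linarith))]
        -- (1 + 20ζ)(1 - 18ζ/5)(1 - ζ) - 1 is ζ times this quadratic, which decreases on [0, 1/5] to
        -- the value 3/5.
        have h5 : 0 ≤ 77 / 5 - 442 / 5 * ζ + 72 * ζ ^ 2 := by nlinarith
        nlinarith [mul_nonneg hζ0 h5]

end Setting

end Feasible

/-! ### Closed loop of a feasible decision on the true system -/

section Robust

variable {n p : ℕ} {A : Matrix (Fin n) (Fin n) ℝ} {B : Matrix (Fin n) (Fin p) ℝ}
  {K : Matrix (Fin p) (Fin n) ℝ} {C s : ℝ} {P : Program n p} {D : Decision n p}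

/-- The perturbation `N` for which the responses on the true system are `Φ (I - N)⁻¹`. -/
def mismatch (A : Matrix (Fin n) (Fin n) ℝ) (B : Matrix (Fin n) (Fin p) ℝ) (P : Program n p)
    (D : Decision n p) : TransferMatrix (Fin n) (Fin n) :=
  fun k => single P.F (-D.V) k +
    Matrix.fromCols (A - P.Ahat) (B - P.Bhat) * stack D.Φx D.Φu k

lemma weighted_conv {Q : Matrix (Fin n) (Fin n) ℝ} {R : Matrix (Fin p) (Fin p) ℝ}
    (X : TransferMatrix (Fin n) (Fin n)) (U : TransferMatrix (Fin p) (Fin n))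
    (N : TransferMatrix (Fin n) (Fin n)) :
    weighted Q R (conv X N) (conv U N) = conv (weighted Q R X U) N := by
  funext k
  ext i j
  rw [conv_apply, Matrix.sum_apply]
  rcases i with i | i
  · change (CFC.sqrt Q * conv X N k) i j = ∑ x ∈ antidiagonal k, (CFC.sqrt Q * X x.1 * N x.2) i j
    rw [conv_apply, Matrix.mul_sum, Matrix.sum_apply]
    simp only [Matrix.mul_assoc]
  · change (CFC.sqrt R * conv U N k) i j = ∑ x ∈ antidiagonal k, (CFC.sqrt R * U x.1 * N x.2) i j
    rw [conv_apply, Matrix.mul_sum, Matrix.sum_apply]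
    simp only [Matrix.mul_assoc]

/-- A feasible decision, for estimates within `ε` of the plant and tail bound at most `1 / 2`. -/
structure FeasibleSetting (A : Matrix (Fin n) (Fin n) ℝ) (B : Matrix (Fin n) (Fin p) ℝ)
    (P : Program n p) (D : Decision n p) : Prop where
  feasible : P.Feasible D
  norm_A_sub : ‖P.Ahat - A‖ ≤ P.ε
  norm_B_sub : ‖P.Bhat - B‖ ≤ P.ε
  tail_le : P.tail ≤ 1 / 2

namespace FeasibleSetting

variable (S : FeasibleSetting A B P D)
include S

lemma eps_nonneg : 0 ≤ P.ε := (norm_nonneg _).trans S.norm_A_sub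

/-- For `F ≥ 1` this is the affine constraint at `k = 0`. For `F = 0` the constraint forces V = -I
with ‖V‖ ≤ 1/2; as ‖I‖ ≤ ‖I‖², the identity is then 0 and the state space is trivial. -/
lemma Φx_one_and_V : D.Φx 1 = 1 ∧ (P.F = 0 → D.V = 0) := by
  have h := S.feasible.affine 0
  rw [S.feasible.affine_zero, S.feasible.memU.2.1, Matrix.mul_zero, Matrix.mul_zero, sub_zero,
    sub_zero, if_pos rfl] at h
  rcases Nat.eq_zero_or_pos P.F with hF | hF
  · have h1 : D.Φx 1 = 0 := S.feasible.memX.2.2 1 (by omega)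
    rw [if_pos hF.symm, zero_add, h1] at h
    have h2 : D.V = -1 := (neg_eq_of_add_eq_zero_right h.symm).symm
    have h3 : ‖(1 : Matrix (Fin n) (Fin n) ℝ)‖ ≤ 1 / 2 := by
      have := S.feasible.norm_V.trans S.tail_le
      rwa [h2, norm_neg] at this
    have h4 : ‖(1 : Matrix (Fin n) (Fin n) ℝ)‖ ≤
        ‖(1 : Matrix (Fin n) (Fin n) ℝ)‖ * ‖(1 : Matrix (Fin n) (Fin n) ℝ)‖ := by
      conv_lhs => rw [← Matrix.one_mul (1 : Matrix (Fin n) (Fin n) ℝ)]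
      exact Matrix.l2_opNorm_mul _ _
    have h5 : (1 : Matrix (Fin n) (Fin n) ℝ) = 0 := by
      rw [← norm_eq_zero]
      nlinarith [norm_nonneg (1 : Matrix (Fin n) (Fin n) ℝ)]
    rw [h1, h2, h5]
    simp
  · rw [if_neg (by omega), add_zero] at h
    exact ⟨h, fun h0 => by omega⟩

omit S in
lemma stack_eq_zero {k : ℕ} (hx : D.Φx k = 0) (hu : D.Φu k = 0) : stack D.Φx D.Φu k = 0 := by
  rw [stack, hx, hu, Matrix.fromRows_zero]

lemma stack_fir (k : ℕ) (hk : P.F + 1 ≤ k) : stack D.Φx D.Φu k = 0 :=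
  stack_eq_zero (S.feasible.memX.2.2 k hk) (S.feasible.memU.2.2 k hk)

lemma mismatch_zero : mismatch A B P D 0 = 0 := by
  rw [mismatch, stack_eq_zero S.feasible.affine_zero S.feasible.memU.2.1, Matrix.mul_zero,
    add_zero, single]
  split_ifs with h
  · rw [S.Φx_one_and_V.2 h.symm, neg_zero]
  · rfl

lemma mismatch_fir (k : ℕ) (hk : P.F + 1 ≤ k) : mismatch A B P D k = 0 := by
  rw [mismatch, S.stack_fir k hk, Matrix.mul_zero, add_zero, single_of_le _ _ _ hk]

/-- Replacing the estimates by the true matrices in the affine constraint moves all the discrepancy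
to the right-hand side, which becomes I - N. -/
lemma responses : D.Φx = conv (responseX A B (controller D.Φx D.Φu))
      (fun k => delta k + -mismatch A B P D k) ∧
    D.Φu = conv (responseU A B (controller D.Φx D.Φu))
      (fun k => delta k + -mismatch A B P D k) := by
  refine responses_of_affine A B S.feasible.affine_zero S.Φx_one_and_V.1 S.feasible.memU.2.1
    fun k => ?_
  have h := S.feasible.affine k
  have h1 : mismatch A B P D k = -(if k = P.F then D.V else 0) +
      ((A - P.Ahat) * D.Φx k + (B - P.Bhat) * D.Φu k) := by
    rw [mismatch, show stack D.Φx D.Φu k = Matrix.fromRows (D.Φx k) (D.Φu k) from rfl,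
      Matrix.fromCols_mul_fromRows, single]
    split_ifs <;> simp
  have h2 : D.Φx (k + 1) = P.Ahat * D.Φx k + P.Bhat * D.Φu k +
      (delta k + (if k = P.F then D.V else 0)) := by
    rw [show (delta k : Matrix (Fin n) (Fin n) ℝ) = if k = 0 then 1 else 0 from rfl, ← h]
    abel
  rw [h2, h1, Matrix.sub_mul, Matrix.sub_mul]
  abel

omit S in
lemma eq_add_conv_of_eq_conv {m : Type*} {X Y : TransferMatrix m (Fin n)}
    {N : TransferMatrix (Fin n) (Fin n)} (h : X = conv Y (fun k => delta k + -N k)) :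
    Y = X + conv Y N := by
  have e : (fun k => delta k + -N k) = delta + -N := rfl
  have h2 : conv Y (-N) = -conv Y N := by funext k; simp [conv_apply]
  rw [e, conv_add_right, conv_delta, h2] at h
  rw [h]
  abel

/-- The residual contributes τ. The model error contributes at most √2 ε ‖Φ‖, which the denominator
1 - τ in the robust constraint turns into (1 - τ)γ. One minus the total factors as (1 - τ)(1 - γ).
-/
lemma norm_eval_mismatch_le (z : Circle) :
    ‖TransferMatrix.eval (mismatch A B P D) z‖ ≤ P.tail + (1 - P.tail) * D.γ := by
  have hτ := S.tail_le
  have hs := summable_norm_of_fir S.stack_fir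
  unfold mismatch
  rw [eval_add (summable_norm_of_fir (single_of_le _ _)) (summable_mul_left _ hs)]
  refine (norm_add_le _ _).trans (add_le_add ?_ ?_)
  · refine (norm_eval_single_le _ _ z).trans ?_
    rw [norm_neg]
    exact S.feasible.norm_V
  · have h1 : ‖Matrix.fromCols (A - P.Ahat) (B - P.Bhat)‖ ≤ Real.sqrt 2 * P.ε :=
      norm_fromCols_le (by rw [norm_sub_rev]; exact S.norm_A_sub)
        (by rw [norm_sub_rev]; exact S.norm_B_sub)
    have h2 := S.feasible.robust
    change Real.sqrt 2 * P.ε / (1 - P.tail) * _ ≤ _ at h2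
    rw [div_mul_eq_mul_div, div_le_iff₀ (by linarith)] at h2
    refine (norm_eval_mul_left_le _ hs z).trans ?_
    refine (mul_le_mul h1 (norm_eval_le_hinfNorm hs z) (norm_nonneg _) ?_).trans (by linarith)
    exact mul_nonneg (Real.sqrt_nonneg _) S.eps_nonneg

/-- Robust performance: the cost on the true system is bounded by the objective. -/
lemma h2Norm_weighted_le :
    IsL2 (weighted P.Q P.R (responseX A B (controller D.Φx D.Φu))
      (responseU A B (controller D.Φx D.Φu))) ∧
    h2Norm (weighted P.Q P.R (responseX A B (controller D.Φx D.Φu))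
      (responseU A B (controller D.Φx D.Φu))) ≤ 1 / (1 - P.tail) * P.objective D := by
  obtain ⟨hx, hu⟩ := S.responses
  have hτ := S.tail_le
  have hγ := S.feasible.γ_lt_one
  have hw : weighted P.Q P.R D.Φx D.Φu = conv (weighted P.Q P.R
      (responseX A B (controller D.Φx D.Φu)) (responseU A B (controller D.Φx D.Φu)))
      (fun k => delta k + -mismatch A B P D k) := by
    rw [← weighted_conv, ← hx, ← hu]
  have hfir : ∀ k, P.F + 1 ≤ k → weighted P.Q P.R D.Φx D.Φu k = 0 := fun k hk => by
    change Matrix.fromRows (CFC.sqrt P.Q * D.Φx k) (CFC.sqrt P.R * D.Φu k) = 0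
    rw [S.feasible.memX.2.2 k (by omega), S.feasible.memU.2.2 k (by omega), Matrix.mul_zero,
      Matrix.mul_zero, Matrix.fromRows_zero]
  have hlt : P.tail + (1 - P.tail) * D.γ < 1 := by nlinarith
  obtain ⟨h1, h2⟩ := h2Norm_le_of_eq_add_conv (eq_add_conv_of_eq_conv hw)
    (summable_norm_of_fir S.mismatch_fir) S.norm_eval_mismatch_le hlt (isL2_of_fir hfir)
  refine ⟨h1, h2.trans (le_of_eq ?_)⟩
  change _ = 1 / (1 - P.tail) * (1 / (1 - D.γ) * h2Norm (weighted P.Q P.R D.Φx D.Φu))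
  rw [← mul_assoc, one_div_mul_one_div]
  congr 3
  ring

end FeasibleSetting

end Robust

/-! ### Existence of an optimal solution -/

section Existence

variable {n p : ℕ} {P : Program n p}

lemma objective_nonneg {D : Decision n p} (hD : P.Feasible D) : 0 ≤ P.objective D :=
  mul_nonneg (one_div_nonneg.2 (by linarith [hD.γ_lt_one])) (h2Norm_nonneg _)

lemma isCompact_closedBall_matrix {m n : ℕ} (r : ℝ) :
    IsCompact (Metric.closedBall (0 : Matrix (Fin m) (Fin n) ℝ) r) := by
  have : ProperSpace (Matrix (Fin m) (Fin n) ℝ) := FiniteDimensional.proper ℝ _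
  exact isCompact_closedBall _ _

/-- A decision from its components. -/
def Decision.ofProd (x : ℝ × TransferMatrix (Fin n) (Fin n) × TransferMatrix (Fin p) (Fin n) ×
    Matrix (Fin n) (Fin n) ℝ) : Decision n p := ⟨x.1, x.2.1, x.2.2.1, x.2.2.2⟩

/-- The set of strictly proper FIR responses within the bounds of the class. -/
def firBox (m n F : ℕ) (C ρ : ℝ) : Set (TransferMatrix (Fin m) (Fin n)) :=
  {M | ∀ k, ‖M k‖ ≤ if 1 ≤ k ∧ k ≤ F then C * ρ ^ k else 0}

/-- A product of closed balls, of radius 0 outside the indices 1, ..., F; compact by Tychonoff. -/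
lemma isCompact_firBox (m n F : ℕ) (C ρ : ℝ) : IsCompact (firBox m n F C ρ) := by
  have h := isCompact_univ_pi fun k : ℕ => isCompact_closedBall_matrix (m := m) (n := n)
    (if 1 ≤ k ∧ k ≤ F then C * ρ ^ k else 0)
  convert h using 1
  ext M
  simp [firBox, Set.mem_pi]

lemma mem_strictFIR_iff {m n F : ℕ} {C ρ : ℝ} (hC : 0 ≤ C) (hρ0 : 0 ≤ ρ) (hρ1 : ρ < 1)
    (M : TransferMatrix (Fin m) (Fin n)) : M ∈ strictFIR F C ρ ↔ M ∈ firBox m n F C ρ := by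
  constructor
  · rintro ⟨⟨_, h1⟩, h2, h3⟩ k
    split_ifs with h
    · exact h1 k h.1
    · rcases Nat.eq_zero_or_pos k with rfl | hk
      · simp [h2]
      · simp [h3 k (by omega)]
  · intro h
    have h0 : ∀ k, ¬(1 ≤ k ∧ k ≤ F) → M k = 0 := fun k hk => by
      have := h k
      rw [if_neg hk] at this
      exact norm_le_zero_iff.1 this
    refine mem_strictFIR hρ0 hρ1 (fun k => ?_) (h0 0 (by omega)) fun k hk => h0 k (by omega)
    have h1 : 0 ≤ C * ρ ^ k := by positivity
    refine (h k).trans ?_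
    split_ifs <;> linarith

/-- Exchanges the supremum for one closed condition per point of the circle, each continuous in
finitely many coefficients. -/
lemma hinfNorm_mul_le_iff {a b : Type*} [Fintype a] [Fintype b] [DecidableEq b]
    {M : TransferMatrix a b} {T : ℕ} (hM : ∀ k, T ≤ k → M k = 0) {c γ : ℝ} (hc : 0 ≤ c) :
    c * hinfNorm M ≤ γ ↔ ∀ z : Circle,
      c * ‖∑ k ∈ range T, ((z : ℂ)⁻¹ ^ k) • (M k).map (fun a : ℝ => (a : ℂ))‖ ≤ γ := by
  constructor
  · intro h z
    rw [← eval_fir hM]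
    exact (mul_le_mul_of_nonneg_left
      (norm_eval_le_hinfNorm (summable_norm_of_fir hM) z) hc).trans h
  · intro h
    rcases hc.eq_or_lt with rfl | hc
    · simpa using h 1
    · rw [← le_div_iff₀' hc]
      refine hinfNorm_le fun z => ?_
      rw [le_div_iff₀' hc, eval_fir hM]
      exact h z

/-- The cap `g` replaces the open condition γ < 1, the only constraint that is not closed. -/
lemma isCompact_feasible (hCx : 0 ≤ P.Cx) (hCu : 0 ≤ P.Cu) (hρ0 : 0 ≤ P.ρ) (hρ1 : P.ρ < 1)
    (hc : 0 ≤ Real.sqrt 2 * P.ε / (1 - P.Cx * P.ρ ^ (P.F + 1))) {g : ℝ} (hg : g < 1) :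
    IsCompact {x | P.Feasible (Decision.ofProd x) ∧ x.1 ≤ g} := by
  set c := Real.sqrt 2 * P.ε / (1 - P.Cx * P.ρ ^ (P.F + 1)) with hcdef
  have hbox := (isCompact_Icc (a := (0 : ℝ)) (b := g)).prod
    ((isCompact_firBox n n P.F P.Cx P.ρ).prod ((isCompact_firBox p n P.F P.Cu P.ρ).prod
      (isCompact_closedBall_matrix (m := n) (n := n) (P.Cx * P.ρ ^ (P.F + 1)))))
  have hfirM : ∀ {m : ℕ} {C : ℝ} {M : TransferMatrix (Fin m) (Fin n)}, M ∈ firBox m n P.F C P.ρ →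
      ∀ k, P.F + 1 ≤ k → M k = 0 := fun {m C M} h k hk => by
    have := h k
    rw [if_neg (by omega)] at this
    exact norm_le_zero_iff.1 this
  have e : {x | P.Feasible (Decision.ofProd x) ∧ x.1 ≤ g} =
      (Set.Icc 0 g ×ˢ (firBox n n P.F P.Cx P.ρ ×ˢ (firBox p n P.F P.Cu P.ρ ×ˢ
        Metric.closedBall 0 (P.Cx * P.ρ ^ (P.F + 1))))) ∩
      ({x | ∀ k, x.2.1 (k + 1) - P.Ahat * x.2.1 k - P.Bhat * x.2.2.1 k =
        (if k = 0 then 1 else 0) + (if k = P.F then x.2.2.2 else 0)} ∩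
      {x | ∀ z : Circle, c * ‖∑ k ∈ range (P.F + 1), ((z : ℂ)⁻¹ ^ k) •
        (Matrix.fromRows (x.2.1 k) (x.2.2.1 k)).map (fun a : ℝ => (a : ℂ))‖ ≤ x.1}) := by
    ext ⟨γ, X, U, V⟩
    constructor
    · rintro ⟨h, hγ⟩
      have hX := (mem_strictFIR_iff hCx hρ0 hρ1 _).1 h.memX
      have hU := (mem_strictFIR_iff hCu hρ0 hρ1 _).1 h.memU
      refine ⟨⟨⟨h.γ_nonneg, hγ⟩, hX, hU, mem_closedBall_zero_iff.2 h.norm_V⟩, h.affine, ?_⟩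
      exact (hinfNorm_mul_le_iff (fun k hk =>
        (congrArg₂ Matrix.fromRows (hfirM hX k hk) (hfirM hU k hk)).trans
          Matrix.fromRows_zero) hc).1 h.robust
    · rintro ⟨⟨hγ, hX, hU, hV⟩, ha, hr⟩
      refine ⟨⟨hγ.1, lt_of_le_of_lt hγ.2 hg, ?_, ha, ?_, mem_closedBall_zero_iff.1 hV,
        (mem_strictFIR_iff hCx hρ0 hρ1 _).2 hX, (mem_strictFIR_iff hCu hρ0 hρ1 _).2 hU⟩, hγ.2⟩
      · have := hX 0
        rw [if_neg (by omega)] at this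
        exact norm_le_zero_iff.1 this
      · exact (hinfNorm_mul_le_iff (fun k hk =>
          (congrArg₂ Matrix.fromRows (hfirM hX k hk) (hfirM hU k hk)).trans
            Matrix.fromRows_zero) hc).2 hr
  rw [e]
  refine hbox.inter_right (IsClosed.inter ?_ ?_)
  · rw [Set.ofPred_forall]
    refine isClosed_iInter fun k => isClosed_eq ?_ ?_
    · fun_prop
    · split_ifs <;> fun_prop
  · rw [Set.ofPred_forall]
    refine isClosed_iInter fun z => isClosed_le ?_ (by fun_prop)
    refine continuous_const.mul (continuous_norm.comp ?_)
    refine continuous_finsetSum _ fun k _ => continuous_matrix fun i j => ?_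
    refine continuous_const.mul (Complex.continuous_ofReal.comp ?_)
    rcases i with i | i
    · change Continuous fun x : ℝ × TransferMatrix (Fin n) (Fin n) ×
        TransferMatrix (Fin p) (Fin n) × Matrix (Fin n) (Fin n) ℝ => x.2.1 k i j
      fun_prop
    · change Continuous fun x : ℝ × TransferMatrix (Fin n) (Fin n) ×
        TransferMatrix (Fin p) (Fin n) × Matrix (Fin n) (Fin n) ℝ => x.2.2.1 k i j
      fun_prop

lemma continuousOn_objective {g : ℝ} (hg : g < 1) : ContinuousOn
    (fun x => P.objective (Decision.ofProd x)) {x | P.Feasible (Decision.ofProd x) ∧ x.1 ≤ g} := by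
  have h : ContinuousOn (fun x : ℝ × TransferMatrix (Fin n) (Fin n) ×
      TransferMatrix (Fin p) (Fin n) × Matrix (Fin n) (Fin n) ℝ =>
      1 / (1 - x.1) * Real.sqrt (∑ k ∈ range (P.F + 1),
        ((∑ i, ∑ j, (CFC.sqrt P.Q * x.2.1 k) i j ^ 2) +
          ∑ i, ∑ j, (CFC.sqrt P.R * x.2.2.1 k) i j ^ 2)))
      {x | P.Feasible (Decision.ofProd x) ∧ x.1 ≤ g} := by
    refine ContinuousOn.mul ?_ (Continuous.continuousOn ?_)
    · refine ContinuousOn.div continuousOn_const (by fun_prop) fun x hx => ?_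
      have := hx.2
      linarith
    · refine Real.continuous_sqrt.comp (continuous_finsetSum _ fun k _ => Continuous.add ?_ ?_)
      · refine continuous_finsetSum _ fun i _ => continuous_finsetSum _ fun j _ => ?_
        refine Continuous.pow (Continuous.matrix_elem ?_ i j) 2
        fun_prop
      · refine continuous_finsetSum _ fun i _ => continuous_finsetSum _ fun j _ => ?_
        refine Continuous.pow (Continuous.matrix_elem ?_ i j) 2
        fun_prop
  refine h.congr fun x hx => ?_
  have hf := hx.1
  change 1 / (1 - x.1) * Real.sqrt _ = _
  congr 2
  rw [tsum_eq_sum (s := range (P.F + 1))]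
  · refine Finset.sum_congr rfl fun k _ => ?_
    rw [Fintype.sum_sum_type]
    rfl
  · intro k hk
    have hk' : P.F < k := by simpa using hk
    rw [Fintype.sum_sum_type]
    change (∑ i, ∑ j, (CFC.sqrt P.Q * (Decision.ofProd x).Φx k) i j ^ 2) +
      (∑ i, ∑ j, (CFC.sqrt P.R * (Decision.ofProd x).Φu k) i j ^ 2) = 0
    rw [hf.memX.2.2 k hk', hf.memU.2.2 k hk']
    simp

/-- The objective blows up at least like c/(1 - γ), so decisions with value below `m` have γ ≤ 1 -
c/m. A minimizer over that compact set is then global. -/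
lemma exists_isOptimal (hCx : 0 ≤ P.Cx) (hCu : 0 ≤ P.Cu) (hρ0 : 0 ≤ P.ρ) (hρ1 : P.ρ < 1)
    (hc : 0 ≤ Real.sqrt 2 * P.ε / (1 - P.Cx * P.ρ ^ (P.F + 1))) {D₀ : Decision n p}
    (hD₀ : P.Feasible D₀) {c : ℝ} (hcpos : 0 < c)
    (hlow : ∀ D, P.Feasible D → c / (1 - D.γ) ≤ P.objective D) : ∃ D, P.IsOptimal D := by
  -- The added 1 puts `D₀` strictly below the threshold, so that the compact set is nonempty.
  set m := P.objective D₀ + 1 with hm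
  have hm0 : 0 < m := by linarith [objective_nonneg hD₀]
  have hg : 1 - c / m < 1 := by linarith [div_pos hcpos hm0]
  have hbig : ∀ D, P.Feasible D → P.objective D < m → D.γ ≤ 1 - c / m := by
    intro D hD h
    have h1 := (hlow D hD).trans_lt h
    have h2 : 0 < 1 - D.γ := by linarith [hD.γ_lt_one]
    rw [div_lt_iff₀ h2] at h1
    have h3 : c / m < 1 - D.γ := by rw [div_lt_iff₀ hm0]; linarith
    linarith
  obtain ⟨x, hx, hmin⟩ := (isCompact_feasible hCx hCu hρ0 hρ1 hc hg).exists_isMinOn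
    ⟨(D₀.γ, D₀.Φx, D₀.Φu, D₀.V), hD₀, hbig D₀ hD₀ (by linarith)⟩ (continuousOn_objective hg)
  refine ⟨Decision.ofProd x, hx.1, fun D hD => ?_⟩
  have hle : ∀ D, P.Feasible D → P.objective D < m →
      P.objective (Decision.ofProd x) ≤ P.objective D := fun D hD h =>
    hmin (a := (D.γ, D.Φx, D.Φu, D.V)) ⟨hD, hbig D hD h⟩
  rcases lt_or_ge (P.objective D) m with h | h
  · exact hle D hD h
  · exact (hle D₀ hD₀ (by linarith)).trans (by linarith)

/-- Of the whole H₂ norm only the coefficient Φx[1] = I is kept. -/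
lemma sqrt_froSq_div_le_objective {D : Decision n p} (hD : P.Feasible D) (h1 : D.Φx 1 = 1) :
    Real.sqrt (froSq (CFC.sqrt P.Q)) / (1 - D.γ) ≤ P.objective D := by
  have hγ : 0 < 1 - D.γ := by linarith [hD.γ_lt_one]
  change _ ≤ 1 / (1 - D.γ) * h2Norm (weighted P.Q P.R D.Φx D.Φu)
  rw [div_eq_mul_one_div, mul_comm]
  refine mul_le_mul_of_nonneg_left ?_ (by positivity)
  rw [h2Norm_eq]
  refine Real.sqrt_le_sqrt ?_
  have hfir : ∀ k, P.F + 1 ≤ k → weighted P.Q P.R D.Φx D.Φu k = 0 := fun k hk => by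
    change Matrix.fromRows (CFC.sqrt P.Q * D.Φx k) (CFC.sqrt P.R * D.Φu k) = 0
    rw [hD.memX.2.2 k (by omega), hD.memU.2.2 k (by omega), Matrix.mul_zero,
      Matrix.mul_zero, Matrix.fromRows_zero]
  refine le_trans ?_ ((isL2_of_fir hfir).le_tsum 1 fun _ _ => froSq_nonneg _)
  change _ ≤ froSq (Matrix.fromRows (CFC.sqrt P.Q * D.Φx 1) (CFC.sqrt P.R * D.Φu 1))
  rw [h1, Matrix.mul_one, froSq, froSq, Fintype.sum_sum_type]
  refine le_add_of_le_of_nonneg le_rfl (by positivity)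

end Existence

/-! ### Rationality and decay of the closed-loop responses -/

section Decay

variable {m n : ℕ}

/-- Power series here are in z⁻¹. Reflecting `d` gives the polynomial zᴺ d(1/z), and the coefficient
of z⁻ʲ in its product with `Y` is coefficient `N + j` of `q`, zero once `N` bounds the degrees. -/
lemma isRational_of_mul_eq {Y : TransferMatrix (Fin m) (Fin n)} {d : Polynomial ℝ} (hd : d ≠ 0)
    {q : Fin m → Fin n → Polynomial ℝ}
    (h : ∀ i j, (d : PowerSeries ℝ) * PowerSeries.mk (fun k => Y k i j) = q i j) :
    IsRational Y := by
  obtain ⟨N, hdN, hqN⟩ : ∃ N, d.natDegree ≤ N ∧ ∀ i j, (q i j).natDegree ≤ N := by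
    refine ⟨d.natDegree + ∑ i, ∑ j, (q i j).natDegree, Nat.le_add_right _ _, fun i j => ?_⟩
    refine le_trans ?_ (Nat.le_add_left _ _)
    refine le_trans ?_ (Finset.single_le_sum (f := fun i => ∑ j, (q i j).natDegree)
      (fun _ _ => Nat.zero_le _) (Finset.mem_univ i))
    exact Finset.single_le_sum (f := fun j => (q i j).natDegree) (fun _ _ => Nat.zero_le _)
      (Finset.mem_univ j)
  refine ⟨d.reflect N, by simpa using hd, fun j hj => ?_⟩
  have hlt : (d.reflect N).natDegree < N + 1 := by
    rw [Nat.lt_succ_iff, Polynomial.natDegree_le_iff_coeff_eq_zero]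
    intro i hi
    rw [Polynomial.coeff_reflect, Polynomial.revAt_eq_self_of_lt hi]
    exact Polynomial.coeff_eq_zero_of_natDegree_lt (by omega)
  rw [Polynomial.sum_over_range' (f := fun i c => c • Y (j + i)) _
    (fun i => zero_smul ℝ (Y (j + i))) (N + 1) hlt]
  ext a b
  have h1 := congrArg (PowerSeries.coeff (N + j)) (h a b)
  rw [Polynomial.coeff_coe, Polynomial.coeff_eq_zero_of_natDegree_lt
    (lt_of_le_of_lt (hqN a b) (by omega)), PowerSeries.coeff_mul,
    Finset.Nat.sum_antidiagonal_eq_sum_range_succ (fun l l' => PowerSeries.coeff l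
      (d : PowerSeries ℝ) * PowerSeries.coeff l' (PowerSeries.mk fun k => Y k a b))] at h1
  rw [Matrix.sum_apply, Matrix.zero_apply, ← Finset.sum_range_reflect, ← h1]
  refine Finset.sum_subset_zero_on_sdiff (Finset.range_subset_range.2 (by omega)) ?_ ?_
  · intro l hl
    have hl' : N < l := by simpa using (Finset.mem_sdiff.1 hl).2
    rw [Polynomial.coeff_coe, Polynomial.coeff_eq_zero_of_natDegree_lt (by omega), zero_mul]
  · intro l hl
    have hl' : l ≤ N := by simpa [Nat.lt_succ_iff] using hl
    rw [Polynomial.coeff_coe, PowerSeries.coeff_mk, Matrix.smul_apply, smul_eq_mul,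
      Polynomial.coeff_reflect, Polynomial.revAt_le (by omega)]
    congr 2 <;> omega

/-- Cramer's rule: Y E = X with E and X polynomial in z⁻¹ gives det(E) Y = X adj(E), and det(E) is
nonzero because E has constant term I. -/
lemma isRational_of_eq_conv {X Y : TransferMatrix (Fin m) (Fin n)}
    {N : TransferMatrix (Fin n) (Fin n)} {T : ℕ} (h : X = conv Y (fun k => delta k + -N k))
    (hX : ∀ k, T ≤ k → X k = 0) (hN : ∀ k, T ≤ k → N k = 0) (hN0 : N 0 = 0) : IsRational Y := by
  set E : TransferMatrix (Fin n) (Fin n) := fun k => delta k + -N k with hE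
  have hE0 : E 0 = 1 := by simp [hE, hN0, delta]
  have hET : ∀ k, T + 1 ≤ k → E k = 0 := fun k hk => by
    rw [hE]
    simp only [hN k (by omega), neg_zero, add_zero, delta]
    exact if_neg (by omega)
  let poly : {m : ℕ} → TransferMatrix (Fin m) (Fin n) → Matrix (Fin m) (Fin n) (Polynomial ℝ) :=
    fun M => Matrix.of fun i j => ∑ k ∈ range (T + 1), Polynomial.monomial k (M k i j)
  have hpoly : ∀ {m : ℕ} (M : TransferMatrix (Fin m) (Fin n)), (∀ k, T + 1 ≤ k → M k = 0) →
      ∀ i j k, (poly M i j).coeff k = M k i j := by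
    intro m M hM i j k
    simp only [poly, Matrix.of_apply, Polynomial.finsetSum_coeff, Polynomial.coeff_monomial]
    rw [Finset.sum_ite_eq' (range (T + 1)) k]
    split_ifs with hk
    · rfl
    · rw [hM k (by simpa using hk), Matrix.zero_apply]
  let φ : Polynomial ℝ →+* PowerSeries ℝ := Polynomial.coeToPowerSeries.ringHom
  have hφ : ∀ f, φ f = (f : PowerSeries ℝ) := fun f => rfl
  let y : Matrix (Fin m) (Fin n) (PowerSeries ℝ) :=
    Matrix.of fun i j => PowerSeries.mk fun k => Y k i j
  have hy : y * (poly E).map φ = (poly X).map φ := by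
    ext i j k
    rw [Matrix.mul_apply, map_sum]
    simp only [Matrix.map_apply, hφ, PowerSeries.coeff_mul, Polynomial.coeff_coe, hpoly E hET,
      hpoly X (fun k hk => hX k (by omega)), y, Matrix.of_apply, PowerSeries.coeff_mk]
    rw [h, conv_apply, Matrix.sum_apply, Finset.sum_comm]
    simp only [Matrix.mul_apply]
  have hdet : (poly E).det ≠ 0 := by
    intro h0
    have h1 : ((poly E).map (Polynomial.evalRingHom (0 : ℝ))).det = 0 := by
      rw [← RingHom.mapMatrix_apply, ← RingHom.map_det, h0, map_zero]
    have h2 : (poly E).map (Polynomial.evalRingHom (0 : ℝ)) = 1 := by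
      rw [← hE0]
      ext i j
      rw [Matrix.map_apply, Polynomial.coe_evalRingHom, ← Polynomial.coeff_zero_eq_eval_zero,
        hpoly E hET]
    rw [h2, Matrix.det_one] at h1
    exact one_ne_zero h1
  refine isRational_of_mul_eq hdet (q := poly X * (poly E).adjugate) fun i j => ?_
  have h3 : y * ((poly E).map φ * ((poly E).adjugate).map φ) =
      (poly X * (poly E).adjugate).map φ := by
    rw [← Matrix.mul_assoc, hy, Matrix.map_mul]
  rw [← Matrix.map_mul, Matrix.mul_adjugate] at h3
  have h4 := congrFun (congrFun h3 i) j
  rw [Matrix.map_apply, hφ] at h4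
  rw [← h4, Matrix.map_smul' _ _ _ (fun a b => map_mul φ a b),
    Matrix.map_one _ (map_zero φ) (map_one φ), Matrix.mul_smul, Matrix.mul_one]
  rfl

/-- The factor 5 is (1 - 4/5)⁻¹. Since `N 0 = 0`, each coefficient of the convolution involves only
earlier coefficients of `Y`, and the induction closes. -/
lemma norm_le_of_eq_add_conv {X Y : TransferMatrix (Fin m) (Fin n)}
    {N : TransferMatrix (Fin n) (Fin n)} {c r : ℝ} (hr : 0 < r) (hc : 0 ≤ c)
    (h : Y = X + conv Y N) (hX : ∀ k, ‖X k‖ ≤ c * r ^ k) (hN0 : N 0 = 0)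
    (hN : ∀ k, ∑ j ∈ range (k + 1), ‖N j‖ * r⁻¹ ^ j ≤ 4 / 5) (k : ℕ) :
    ‖Y k‖ ≤ 5 * c * r ^ k := by
  induction k using Nat.strong_induction_on with
  | _ k ih =>
    have h1 : ‖conv Y N k‖ ≤ ∑ x ∈ antidiagonal k, 5 * c * r ^ k * (‖N x.2‖ * r⁻¹ ^ x.2) := by
      rw [conv_apply]
      refine (norm_sum_le _ _).trans (Finset.sum_le_sum fun x hx => ?_)
      have hx' := Finset.HasAntidiagonal.mem_antidiagonal.1 hx
      rcases Nat.eq_zero_or_pos x.2 with h0 | h0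
      · rw [h0, hN0]; simp
      · refine (Matrix.l2_opNorm_mul _ _).trans ?_
        refine (mul_le_mul_of_nonneg_right (ih x.1 (by omega)) (norm_nonneg _)).trans
          (le_of_eq ?_)
        rw [← hx', pow_add, inv_pow]
        field_simp
    have h2 : ∑ x ∈ antidiagonal k, 5 * c * r ^ k * (‖N x.2‖ * r⁻¹ ^ x.2) =
        5 * c * r ^ k * ∑ j ∈ range (k + 1), ‖N j‖ * r⁻¹ ^ j := by
      rw [← Finset.mul_sum, ← Finset.Nat.sum_antidiagonal_swap]
      congr 1
      exact Finset.Nat.sum_antidiagonal_eq_sum_range_succ (fun i _ => ‖N i‖ * r⁻¹ ^ i) k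
    have h3 : 0 ≤ 5 * c * r ^ k := by positivity
    have h4 := mul_le_mul_of_nonneg_left (hN k) h3
    rw [h, Pi.add_apply]
    refine (norm_add_le _ _).trans ((add_le_add (hX k) (h1.trans (h2.le.trans h4))).trans ?_)
    linarith

lemma mem_RHinf_of_eq_conv {X Y : TransferMatrix (Fin m) (Fin n)}
    {N : TransferMatrix (Fin n) (Fin n)} {T : ℕ} {c r C : ℝ} (hr : 0 < r) (hr1 : r < 1)
    (hc : 0 ≤ c) (h : X = conv Y (fun k => delta k + -N k)) (hX : ∀ k, ‖X k‖ ≤ c * r ^ k)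
    (hXT : ∀ k, T ≤ k → X k = 0) (hNT : ∀ k, T ≤ k → N k = 0) (hN0 : N 0 = 0)
    (hN : ∀ k, ∑ j ∈ range (k + 1), ‖N j‖ * r⁻¹ ^ j ≤ 4 / 5) (hC : 5 * c ≤ C) :
    Y ∈ RHinf C r := by
  have hb := norm_le_of_eq_add_conv hr hc (FeasibleSetting.eq_add_conv_of_eq_conv h) hX hN0 hN
  refine ⟨⟨isRational_of_eq_conv h hXT hNT hN0, 5 * c, r, hr1, hr.le, hb⟩, fun k _ => ?_⟩
  exact (hb k).trans (mul_le_mul_of_nonneg_right hC (by positivity))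

/-- The tail bound is small compared to `(0.999 + 0.001 s)^F`. -/
lemma tail_le_mul_pow {τ s ρ r : ℝ} {F : ℕ} (hs0 : 0 < s) (hs1 : s < 1)
    (hρ : ρ = 1 / 4 * s + 3 / 4) (hr : r = 0.999 + 0.001 * s) (hτ0 : 0 ≤ τ) (hτ : τ ≤ 1 / 2)
    (hτF : τ ^ 2 ≤ 4 * ρ ^ F) : τ ≤ 3 / 4 * r ^ F := by
  have hr0 : 0 < r := by rw [hr]; positivity
  have hρ0 : 0 < ρ := by rw [hρ]; positivity
  -- Bernoulli's inequality: r = 1 - (1 - s)/1000 and ρ = 1 - 250(1 - s)/1000.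
  have hb : ρ ≤ r ^ 250 := by
    have h := one_add_mul_le_pow (a := r - 1) (by rw [hr]; norm_num; linarith) 250
    rw [add_sub_cancel] at h
    refine le_trans (le_of_eq ?_) h
    rw [hρ, hr]; norm_num; ring
  rw [← pow_le_pow_iff_left₀ hτ0 (by positivity) (by norm_num : 250 ≠ 0)]
  -- The bound on τ² alone gives the right rate with constant 2. Interpolating with τ ≤ 1/2 at
  -- exponent 250 brings the constant below 3/4 and slows the rate to r.
  calc τ ^ 250 = τ ^ 248 * τ ^ 2 := by rw [← pow_add]
    _ ≤ (1 / 2) ^ 248 * (4 * ρ ^ F) := by gcongr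
    _ ≤ (1 / 2) ^ 248 * (4 * (r ^ 250) ^ F) := by gcongr
    _ = ((1 / 2) ^ 248 * 4) * (r ^ F) ^ 250 := by rw [← pow_mul, ← pow_mul, mul_comm F]; ring
    _ ≤ (3 / 4) ^ 250 * (r ^ F) ^ 250 := by gcongr; norm_num
    _ = (3 / 4 * r ^ F) ^ 250 := by rw [mul_pow]

end Decay

/-! ### Weighted ℓ¹ bound on the mismatch of a feasible decision. -/

section DecayFeasible

variable {n p : ℕ} {A : Matrix (Fin n) (Fin n) ℝ} {B : Matrix (Fin n) (Fin p) ℝ}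
  {s : ℝ} {P : Program n p} {D : Decision n p}

lemma norm_le_of_mem_strictFIR {m : ℕ} {F : ℕ} {C ρ : ℝ} {M : TransferMatrix (Fin m) (Fin n)}
    (hC : 0 ≤ C) (h : M ∈ strictFIR F C ρ) (k : ℕ) : ‖M k‖ ≤ C * ρ ^ k := by
  rcases Nat.eq_zero_or_pos k with rfl | hk
  · rw [h.2.1]; simpa using hC
  · exact h.1.2 k hk

lemma FeasibleSetting.norm_mismatch_le (S : FeasibleSetting A B P D) (hCx : 0 ≤ P.Cx)
    (hCu : 0 ≤ P.Cu) (k : ℕ) : ‖mismatch A B P D k‖ ≤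
      (if k = P.F then P.tail else 0) + P.ε * (P.Cx + P.Cu) * P.ρ ^ k := by
  rw [mismatch, show stack D.Φx D.Φu k = Matrix.fromRows (D.Φx k) (D.Φu k) from rfl,
    Matrix.fromCols_mul_fromRows]
  refine (norm_add_le _ _).trans (add_le_add ?_ ?_)
  · rw [single]
    split_ifs
    · rw [norm_neg]; exact S.feasible.norm_V
    · rw [norm_zero]
  · have hA := S.norm_A_sub
    have hB := S.norm_B_sub
    rw [norm_sub_rev] at hA hB
    refine (norm_add_le _ _).trans ((add_le_add
      ((Matrix.l2_opNorm_mul _ _).trans (mul_le_mul hA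
        (norm_le_of_mem_strictFIR hCx S.feasible.memX k) (norm_nonneg _) S.eps_nonneg))
      ((Matrix.l2_opNorm_mul _ _).trans (mul_le_mul hB
        (norm_le_of_mem_strictFIR hCu S.feasible.memU k) (norm_nonneg _) S.eps_nonneg))).trans
      (le_of_eq (by ring)))

/-- 4/5 = 3/4 + 1/20: the residual `V` at the single index `F`, and a geometric series of ratio ρ/r
for the model error. -/
lemma FeasibleSetting.sum_mismatch_le (S : FeasibleSetting A B P D) (hCx : 0 ≤ P.Cx)
    (hCu : 0 ≤ P.Cu) (hs0 : 0 < s) (hs1 : s < 1) (hρ : P.ρ = 1 / 4 * s + 3 / 4)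
    (hτF : P.tail ^ 2 ≤ 4 * P.ρ ^ P.F) (hε : P.ε * (P.Cx + P.Cu) ≤ 0.01 * (1 - s) ^ 2) (k : ℕ) :
    ∑ j ∈ range (k + 1), ‖mismatch A B P D j‖ * (0.999 + 0.001 * s)⁻¹ ^ j ≤ 4 / 5 := by
  set r := 0.999 + 0.001 * s with hr
  have hr0 : 0 < r := by rw [hr]; positivity
  have hρ0 : 0 < P.ρ := by rw [hρ]; positivity
  have hρr : P.ρ < r := by rw [hρ, hr]; norm_num; linarith
  have hτ0 : 0 ≤ P.tail := by unfold Program.tail; positivity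
  have hτ := tail_le_mul_pow hs0 hs1 hρ hr hτ0 S.tail_le hτF
  have h1 : ∀ j, ‖mismatch A B P D j‖ * r⁻¹ ^ j ≤
      (if j = P.F then 3 / 4 else 0) + 0.01 * (1 - s) ^ 2 * (r⁻¹ * P.ρ) ^ j := fun j => by
    refine (mul_le_mul_of_nonneg_right (S.norm_mismatch_le hCx hCu j) (by positivity)).trans ?_
    rw [add_mul]
    refine add_le_add ?_ ?_
    · split_ifs with hj
      · rw [hj, inv_pow, ← div_eq_mul_inv, div_le_iff₀ (by positivity)]
        exact hτ
      · simp
    · rw [mul_pow, mul_assoc, mul_comm (P.ρ ^ j)]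
      exact mul_le_mul_of_nonneg_right hε (by positivity)
  refine (Finset.sum_le_sum fun j _ => h1 j).trans ?_
  rw [Finset.sum_add_distrib, ← Finset.mul_sum]
  have h2 : ∑ j ∈ range (k + 1), (if j = P.F then (3 / 4 : ℝ) else 0) ≤ 3 / 4 := by
    rw [Finset.sum_ite_eq' (range (k + 1)) P.F]
    split_ifs <;> norm_num
  have ha0 : 0 ≤ r⁻¹ * P.ρ := by positivity
  have ha1 : r⁻¹ * P.ρ < 1 := by rw [inv_mul_lt_iff₀ hr0]; linarith
  -- 0.249 arises from r - ρ = 0.249(1 - s).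
  have h3 : ∑ j ∈ range (k + 1), (r⁻¹ * P.ρ) ^ j ≤ 1 / (0.249 * (1 - s)) := by
    refine ((summable_geometric_of_lt_one ha0 ha1).sum_le_tsum _
      fun _ _ => by positivity).trans ?_
    rw [tsum_geometric_of_lt_one ha0 ha1, inv_eq_one_div]
    refine one_div_le_one_div_of_le (by norm_num; linarith) ?_
    have h4 : r * (1 - r⁻¹ * P.ρ) = 0.249 * (1 - s) := by
      rw [mul_sub, mul_one, ← mul_assoc, mul_inv_cancel₀ hr0.ne', one_mul, hρ, hr]
      norm_num; ring
    have hr1 : r ≤ 1 := by rw [hr]; norm_num; linarith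
    nlinarith
  have h5 : 0.01 * (1 - s) ^ 2 * ∑ j ∈ range (k + 1), (r⁻¹ * P.ρ) ^ j ≤ 1 / 20 := by
    refine (mul_le_mul_of_nonneg_left h3 (by positivity)).trans ?_
    have h6 : 0 < 1 - s := by linarith
    rw [mul_one_div, div_le_div_iff₀ (by positivity) (by norm_num)]
    norm_num
    nlinarith
  linarith

end DecayFeasible

/-! ### Optimality, suboptimality bound and decay for the program -/

section Assembly

lemma mul_pow_le_one_of_log_le {a ρ x : ℝ} {m : ℕ} (ha : 0 ≤ a) (hρ0 : 0 < ρ) (hρ1 : ρ < 1)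
    (h : Real.log a / Real.log (1 / ρ) ≤ x) (hx : x ≤ m) : a * ρ ^ m ≤ 1 := by
  -- At a = 0 the hypothesis involves the default value `Real.log 0 = 0`, but the conclusion is
  -- trivial.
  rcases ha.eq_or_lt with rfl | ha
  · simp
  have hl : 0 < Real.log (1 / ρ) := Real.log_pos (by rw [lt_div_iff₀ hρ0]; linarith)
  have h1 := (div_le_iff₀ hl).1 (h.trans hx)
  rw [← Real.log_pow, Real.log_le_log_iff ha (by positivity), one_div, inv_pow] at h1
  calc a * ρ ^ m ≤ (ρ ^ m)⁻¹ * ρ ^ m := mul_le_mul_of_nonneg_right h1 (by positivity)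
    _ = 1 := inv_mul_cancel₀ (by positivity)

variable {n p : ℕ} {A : Matrix (Fin n) (Fin n) ℝ} {B : Matrix (Fin n) (Fin p) ℝ}
  {Q : Matrix (Fin n) (Fin n) ℝ} {R : Matrix (Fin p) (Fin p) ℝ}

lemma hasLQRCost_zero (hR : R.PosSemidef) :
    HasLQRCost A B (0 : Matrix (Fin n) (Fin n) ℝ) R (ltiPolicy (const 0)) 0 := by
  have hw : weighted (0 : Matrix (Fin n) (Fin n) ℝ) R (responseX A B (const 0))
      (responseU A B (const 0)) = fun _ => 0 := by
    funext k
    change Matrix.fromRows (CFC.sqrt 0 * _) (CFC.sqrt R * responseU A B (const 0) k) = 0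
    rw [responseU_const, CFC.sqrt_zero, Matrix.zero_mul]
    simp only [Matrix.zero_mul, Matrix.mul_zero, Matrix.fromRows_zero]
  have hz : IsL2 (fun _ => 0 : TransferMatrix (Fin n ⊕ Fin p) (Fin n)) :=
    isL2_of_fir (T := 0) fun _ _ => rfl
  have h := hasLQRCost_lti (A := A) (B := B) (K := const 0) Matrix.PosSemidef.zero hR
    (by rw [hw]; exact hz)
  rw [hw, h2Norm_sq] at h
  simpa using h

/-- The optimal cost is the squared `H₂` norm of the optimal closed loop. -/
lemma optimalCost_eq {K : Matrix (Fin p) (Fin n) ℝ} {J : ℝ≥0∞} (hQ : Q.PosSemidef)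
    (hR : R.PosSemidef) (h : IsOptimalFeedback A B Q R K J)
    (hS : IsL2 (weighted Q R (res (A + B * K)) (fun k => K * res (A + B * K) k))) :
    J = ENNReal.ofReal (h2Norm (weighted Q R (res (A + B * K))
      (fun k => K * res (A + B * K) k)) ^ 2) := by
  rw [← responseU_const, ← responseX_const] at hS ⊢
  exact tendsto_nhds_unique h.attains (hasLQRCost_lti hQ hR hS)

/-- For Q ≠ 0 the objective is coercive in γ. For Q = 0 the zero control has cost 0, so the optimal
cost is 0; as K attains it, its weighted closed loop vanishes and the static decision has objective
0. -/
lemma Setting.exists_isOptimal {K : Matrix (Fin p) (Fin n) ℝ} {J : ℝ≥0∞} {C s : ℝ}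
    {P : Program n p} (S : Setting A B K C s P) (hQ : P.Q.PosSemidef) (hR : P.R.PosSemidef)
    (h : IsOptimalFeedback A B P.Q P.R K J) : ∃ D, P.IsOptimal D := by
  by_cases hQ0 : CFC.sqrt P.Q = 0
  · refine ⟨staticDecision P K, S.feasible_staticDecision, fun D hD => ?_⟩
    refine le_trans ?_ (objective_nonneg hD)
    have hJ : J = 0 := by
      have hQ' : P.Q = 0 := by
        rw [← CFC.sqrt_mul_sqrt_self P.Q (Matrix.nonneg_iff_posSemidef.2 hQ), hQ0,
          Matrix.zero_mul]
      refine le_antisymm (h.isLeast.2 ⟨ltiPolicy (const 0), ?_⟩) zero_le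
      rw [hQ']
      exact hasLQRCost_zero hR
    have h1 := optimalCost_eq hQ hR h (S.isL2_weighted_res P.Q P.R)
    rw [hJ, eq_comm, ENNReal.ofReal_eq_zero] at h1
    have h2 : h2Norm (weighted P.Q P.R (res (A + B * K)) fun k => K * res (A + B * K) k) = 0 :=
      pow_eq_zero_iff two_ne_zero |>.1 (le_antisymm h1 (sq_nonneg _))
    have h3 := S.objective_staticDecision_le
    rwa [h2, mul_zero] at h3
  · have hpos : 0 < Real.sqrt (froSq (CFC.sqrt P.Q)) :=
      Real.sqrt_pos.2 ((froSq_nonneg _).lt_of_ne fun h0 => hQ0 (froSq_eq_zero h0.symm))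
    refine LQR.exists_isOptimal S.Cx_nonneg S.Cu_nonneg S.ρ_pos.le S.ρ_lt_one ?_
      S.feasible_staticDecision hpos fun D hD => ?_
    · refine div_nonneg (mul_nonneg (Real.sqrt_nonneg _) S.eps_nonneg) ?_
      linarith [S.tail_le]
    · have SD : FeasibleSetting A B P D := ⟨hD, S.norm_A_sub, S.norm_B_sub, S.tail_le⟩
      exact sqrt_froSq_div_le_objective hD SD.Φx_one_and_V.1

/-- Suboptimality of an optimal solution of the program on the true system. -/
lemma Setting.cost_le {K : Matrix (Fin p) (Fin n) ℝ} {J : ℝ≥0∞} {C s CJ : ℝ}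
    {P : Program n p} (S : Setting A B K C s P) (hQ : P.Q.PosSemidef) (hR : P.R.PosSemidef)
    (h : IsOptimalFeedback A B P.Q P.R K J) (hCJ : 0 < CJ) (hτ : (1 + CJ⁻¹) * P.tail ≤ 1)
    {D : Decision n p} (hD : P.IsOptimal D) :
    ∃ J' : ℝ≥0∞, HasLQRCost A B P.Q P.R (ltiPolicy (controller D.Φx D.Φu)) J' ∧
      J' ≤ ENNReal.ofReal ((1 + CJ) ^ 2 * (1 + 20 * (P.ε * (1 + ‖K‖) *
        hinfNorm (res (A + B * K)))) ^ 2) * J := by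
  have SD : FeasibleSetting A B P D := ⟨hD.1, S.norm_A_sub, S.norm_B_sub, S.tail_le⟩
  obtain ⟨h1, h2⟩ := SD.h2Norm_weighted_le
  refine ⟨_, hasLQRCost_lti hQ hR h1, ?_⟩
  rw [optimalCost_eq hQ hR h (S.isL2_weighted_res P.Q P.R),
    ← ENNReal.ofReal_mul (by positivity), ← mul_pow, ← mul_pow]
  refine ENNReal.ofReal_le_ofReal (pow_le_pow_left₀ (h2Norm_nonneg _) (h2.trans ?_) 2)
  have h3 := (hD.2 _ S.feasible_staticDecision).trans S.objective_staticDecision_le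
  have h4 : 0 < 1 - P.tail := by linarith [S.tail_le_half]
  -- (1 + 1/C_J) τ ≤ 1 says τ ≤ C_J/(1 + C_J), which is equivalent to this bound.
  have h5 : 1 / (1 - P.tail) ≤ 1 + CJ := by
    rw [div_le_iff₀ h4]
    have h6 : CJ * ((1 + CJ⁻¹) * P.tail) ≤ CJ * 1 := mul_le_mul_of_nonneg_left hτ hCJ.le
    have h7 : CJ * ((1 + CJ⁻¹) * P.tail) = (CJ + 1) * P.tail := by field_simp
    linarith
  rw [mul_assoc]
  exact mul_le_mul h5 h3 (objective_nonneg hD.1) (by linarith)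

/-- Decay of the true closed-loop responses. -/
lemma Setting.responses_mem_RHinf {K : Matrix (Fin p) (Fin n) ℝ} {C s : ℝ} {P : Program n p}
    (S : Setting A B K C s P) (hτF : P.tail ^ 2 ≤ 4 * P.ρ ^ P.F)
    (hε : P.ε * (P.Cx + P.Cu) ≤ 0.01 * (1 - s) ^ 2) {D : Decision n p} (hD : P.Feasible D) :
    responseX A B (controller D.Φx D.Φu) ∈
      RHinf (500 * C / (1 - s) ^ 3) (0.999 + 0.001 * s) ∧
    responseU A B (controller D.Φx D.Φu) ∈
      RHinf (500 * ‖K‖ * C / (1 - s) ^ 3) (0.999 + 0.001 * s) := by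
  have SD : FeasibleSetting A B P D := ⟨hD, S.norm_A_sub, S.norm_B_sub, S.tail_le⟩
  have hs0 := S.s_pos
  have hs1 := S.s_lt_one
  have hN := SD.sum_mismatch_le S.Cx_nonneg S.Cu_nonneg hs0 hs1 S.ρ_eq hτF hε
  obtain ⟨hx, hu⟩ := SD.responses
  have hr0 : (0 : ℝ) < 0.999 + 0.001 * s := by positivity
  have hr1 : 0.999 + 0.001 * s < 1 := by norm_num; linarith
  have hρr : P.ρ ≤ 0.999 + 0.001 * s := by rw [S.ρ_eq]; norm_num; linarith
  have hpow : ∀ {c : ℝ}, 0 ≤ c → ∀ k : ℕ, c * P.ρ ^ k ≤ c * (0.999 + 0.001 * s) ^ k :=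
    fun hc k => mul_le_mul_of_nonneg_left (pow_le_pow_left₀ S.ρ_pos.le hρr k) hc
  have hd : 0 < 1 - s := by linarith
  -- 500 = 5 · 100. The argument yields a single power of 1 - s in the denominator, which is
  -- stronger than the cube.
  have hcube : ∀ {c : ℝ}, 0 ≤ c → 5 * (100 * c / (1 - s)) ≤ 500 * c / (1 - s) ^ 3 := by
    intro c hc
    have h1 : 5 * (100 * c / (1 - s)) = 500 * c / (1 - s) := by ring
    rw [h1]
    refine div_le_div_of_nonneg_left (by positivity) (by positivity) ?_
    exact pow_le_of_le_one hd.le (by linarith) (by norm_num)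
  constructor
  · refine mem_RHinf_of_eq_conv (T := P.F + 1) hr0 hr1 S.Cx_nonneg hx
      (fun k => (norm_le_of_mem_strictFIR S.Cx_nonneg hD.memX k).trans (hpow S.Cx_nonneg k))
      (fun k hk => hD.memX.2.2 k hk) SD.mismatch_fir SD.mismatch_zero hN ?_
    rw [S.Cx_eq]
    exact hcube S.C_nonneg
  · refine mem_RHinf_of_eq_conv (T := P.F + 1) hr0 hr1 S.Cu_nonneg hu
      (fun k => (norm_le_of_mem_strictFIR S.Cu_nonneg hD.memU k).trans (hpow S.Cu_nonneg k))
      (fun k hk => hD.memU.2.2 k hk) SD.mismatch_fir SD.mismatch_zero hN ?_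
    rw [S.Cu_eq, mul_assoc 100, mul_assoc 500]
    exact hcube (mul_nonneg (norm_nonneg _) S.C_nonneg)

end Assembly

end LQR

/-! ### The theorem: choice of constants and reduction to `Setting`. -/

theorem mainTheorem5 :
    ∃ cx cu cJ cε cX cU : ℝ, 0 < cx ∧ 0 < cu ∧ 0 < cJ ∧ 0 < cε ∧ 0 < cX ∧ 0 < cU ∧
    ∀ (n p : ℕ) (A : Matrix (Fin n) (Fin n) ℝ) (B : Matrix (Fin n) (Fin p) ℝ)
      (Q : Matrix (Fin n) (Fin n) ℝ) (R : Matrix (Fin p) (Fin p) ℝ),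
      Q.PosSemidef → R.PosDef →
    ∀ (Kstar : Matrix (Fin p) (Fin n) ℝ) (Jstar : ℝ≥0∞),
      LQR.IsOptimalFeedback A B Q R Kstar Jstar →
    ∀ Cstar ρstar : ℝ, Real.exp (-1) ≤ ρstar → ρstar < 1 →
      LQR.res (A + B * Kstar) ∈ LQR.RHinf Cstar ρstar →
    ∀ ε : ℝ,
      ε * (1 + ‖Kstar‖) * LQR.hinfNorm (LQR.res (A + B * Kstar)) ≤ 1 / 5 →
      ε * (1 + ‖Kstar‖) * Cstar ≤ 1 - ρstar →
    ∀ (Ahat : Matrix (Fin n) (Fin n) ℝ) (Bhat : Matrix (Fin n) (Fin p) ℝ),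
      max ‖Ahat - A‖ ‖Bhat - B‖ ≤ ε →
    ∀ Cx Cu ρ : ℝ, Cx = cx * Cstar / (1 - ρstar) → Cu = cu * ‖Kstar‖ * Cstar / (1 - ρstar) →
      ρ = 1 / 4 * ρstar + 3 / 4 →
    ∀ CJ : ℝ, 0 < CJ →
    ∀ F₀ : ℝ, Real.log (2 * Cx) / Real.log (1 / ρ) - 1 ≤ F₀ →
      Real.log ((1 + CJ⁻¹) * Cx) / Real.log (1 / ρ) - 1 ≤ F₀ →
    ∀ F : ℕ, F₀ ≤ F →
    ∀ P : LQR.Program n p, P = ⟨Ahat, Bhat, Q, R, ε, Cx, Cu, ρ, F⟩ →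
      (∃ D, P.Feasible D) ∧ (∃ D, P.IsOptimal D) ∧
      ∀ D, P.IsOptimal D →
        (∃ J : ℝ≥0∞, LQR.HasLQRCost A B Q R (LQR.ltiPolicy (LQR.controller D.Φx D.Φu)) J ∧
          J ≤ ENNReal.ofReal ((1 + CJ) ^ 2 * (1 + cJ * (ε * (1 + ‖Kstar‖) *
            LQR.hinfNorm (LQR.res (A + B * Kstar)))) ^ 2) * Jstar) ∧
        (ε * (Cx + Cu) ≤ cε * (1 - ρstar) ^ 2 →
          2 * Real.log (Cx / 2) / Real.log (1 / ρ) - 2 ≤ F →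
          LQR.responseX A B (LQR.controller D.Φx D.Φu) ∈
            LQR.RHinf (cX * Cstar / (1 - ρstar) ^ 3) (0.999 + 0.001 * ρstar) ∧
          LQR.responseU A B (LQR.controller D.Φx D.Φu) ∈
            LQR.RHinf (cU * ‖Kstar‖ * Cstar / (1 - ρstar) ^ 3) (0.999 + 0.001 * ρstar)) := by
  refine ⟨100, 100, 20, 0.01, 500, 500, by norm_num, by norm_num, by norm_num, by norm_num,
    by norm_num, by norm_num, ?_⟩
  intro n p A B Q R hQ hR Kstar Jstar hopt Cstar ρstar hρe hρ1 hres ε hζ hεC Ahat Bhat hest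
    Cx Cu ρ hCx hCu hρ CJ hCJ F₀ hF₁ hF₂ F hF P hP
  have hs0 : 0 < ρstar := (Real.exp_pos _).trans_le hρe
  have hC0 : 0 ≤ Cstar := by
    -- The sign of `Cstar` follows from the decay bound at index 1.
    have h := (norm_nonneg _).trans (hres.2 1 le_rfl)
    rw [pow_one] at h
    exact nonneg_of_mul_nonneg_left h hs0
  have hd : 0 < 1 - ρstar := by linarith
  have hCx0 : 0 ≤ Cx := by rw [hCx]; positivity
  have hρ0 : 0 < ρ := by rw [hρ]; positivity
  have hρlt : ρ < 1 := by rw [hρ]; linarith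
  have hlog : ∀ {a : ℝ}, 0 ≤ a → Real.log a / Real.log (1 / ρ) - 1 ≤ F₀ →
      a * ρ ^ (F + 1) ≤ 1 := fun ha h =>
    LQR.mul_pow_le_one_of_log_le ha hρ0 hρlt le_rfl (by push_cast; linarith)
  have hτ1 := hlog (by positivity) hF₁
  have hτ2 := hlog (mul_nonneg (by positivity) hCx0) hF₂
  have S : LQR.Setting A B Kstar Cstar ρstar P := by
    subst hP
    refine ⟨hC0, hs0, hρ1, fun k => ?_, hζ, hεC, (le_max_left _ _).trans hest,
      (le_max_right _ _).trans hest, hCx, hCu, hρ, ?_⟩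
    -- `RHinf` bounds only the indices `k ≥ 1`; at index 0 the resolvent vanishes.
    · cases k with
      | zero => simpa [LQR.res] using hC0
      | succ k => exact hres.2 (k + 1) (by omega)
    · change Cx * ρ ^ (F + 1) ≤ 1 / 2
      linarith
  subst hP
  refine ⟨⟨_, S.feasible_staticDecision⟩, S.exists_isOptimal hQ hR.posSemidef hopt,
    fun D hD => ⟨S.cost_le hQ hR.posSemidef hopt hCJ ((mul_assoc _ _ _).symm.trans_le hτ2) hD,
      fun hε hF₃ => S.responses_mem_RHinf ?_ hε hD.1⟩⟩
  -- Twice a logarithm is the logarithm of the square, so the extra condition on `F` is this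
  -- inequality. Multiplied by 4ρᶠ it becomes τ² ≤ 4ρᶠ.
  have h1 : (Cx / 2) ^ 2 * ρ ^ (F + 2) ≤ 1 := by
    refine LQR.mul_pow_le_one_of_log_le (sq_nonneg _) hρ0 hρlt le_rfl ?_
    rw [Real.log_pow]
    push_cast
    linarith
  calc (Cx * ρ ^ (F + 1)) ^ 2 = 4 * ((Cx / 2) ^ 2 * ρ ^ (F + 2)) * ρ ^ F := by ring
    _ ≤ 4 * 1 * ρ ^ F := by gcongr
    _ = 4 * ρ ^ F := by ring
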